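/- \textbf{Definitions.} Let $G$ be a finitely generated group. All generating sets are finite and inverse-closed subsets of the group. For a generating set $X$ let $X^*$ be the set of words over $X$; write $l(w)$ for the length of a word $w$, $w=_Gv$ if $w$ and $v$ represent the same element of $G$, and $l_G(w)$ (geodesic length) for the length of a shortest word over $X$ representing the same element as $w$. Let $d$ be the path metric on the 1-skeleton of the Cayley graph of $G$ over $X$ (edges of length $1$ from $g$ to $gx$, $x\in X$, where the edge from $gx$ to $g$ labelled $x^{-1}$ is the reverse of the edge from $g$ to $gx$). For a word $w$ let $t\mapsto w(t)$, $t\ge 0$, be the unit-speed path from $1$ labelled by $w$, constant for $t\ge l(w)$ (and put $w(t)=1$ for $t<0$). Words $v,w\in X^*$ \emph{synchronously $K$-fellow-travel} if $d(v(t),w(t))\le K$ for all $t>0$. They \emph{asynchronously $K$-fellow-travel} if there is a differentiable $h:\mathbf R\to\mathbf R$, strictly increasing on $[0,l(v)+1]$ and mapping $[0,l(v)+1]$ onto $[0,l(w)+1]$, such that $d(v(t),w(h(t)))\le K$ for all $t>0$; they do so \emph{boundedly, with bound $M>0$}, if moreover $1/M\le h'(t)\le M$ for all $t\in\mathbf R$.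 A set $L\subseteq X^*$ containing at least one representative of each element of $G$ is a \emph{synchronous} (respectively \emph{asynchronous}) \emph{combing} for $G$ over $X$ if there is $K\in\mathbf N$ such that all $v,w\in L$ with $w=_Gvx$ for some $x\in X\cup\{1\}$ synchronously (respectively asynchronously) $K$-fellow-travel; it is a \emph{boundedly asynchronous combing} if there are $K\in\mathbf N$ and $M>0$ such that all these pairs asynchronously $K$-fellow-travel with bound $M$. If the maximum exists for every $n\in\mathbf N$, the \emph{length function} $f:\mathbf N\to\mathbf N$ of $L$ is given by $f(n)=\max\{l(w): w\in L,\ l_G(w)\le n\}$. A combing is \emph{real-time} if it is accepted by a deterministic real-time Turing machine: a machine with finitely many states and a fixed finite number of two-way infinite work tapes, initially blank, over a finite alphabet, which at each transition reads the next input symbol, and which, depending on its state, this symbol and the scanned work-tape symbols, changes state and on each work tape writes a symbol and then moves by at most one square; an input word is accepted if the machine is in an accepting state when the whole word has been read. A group is synchronously, asynchronously or boundedly asynchronously real-time combable if it has a real-time combing of that type over some generating set. \textbf{Proposition.} Let $G$ be a finitely generated group, and fix one of the three types of combing (synchronous, asynchronous, boundedly asynchronous). (a) If $X$ and $Y$ are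 generating sets for $G$, then for every real-time combing $L$ for $G$ over $X$ of this type there is a real-time combing $L'$ for $G$ over $Y$ of the same type such that, for every $d\in\mathbf N$, if $L$ has a length function bounded by a polynomial of degree $d$, then so does $L'$. (b) Let $H$ be a subgroup of finite index in $G$. Then $G$ is real-time combable with a combing of this type if and only if $H$ is. Moreover, if $X$ and $Y$ are generating sets for $G$ and $H$ respectively, then for every real-time combing $L$ of this type for $G$ over $X$ (respectively for $H$ over $Y$) there is a real-time combing $L'$ of the same type for $H$ over $Y$ (respectively for $G$ over $X$) such that, for every $d\in\mathbf N$, if $L$ has a length function bounded by a polynomial of degree $d$, then so does $L'$. -/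

import Mathlib

universe u

/-! ### Real-time Turing machines -/

/-- A deterministic real-time Turing machine with input alphabet `A`. The input tape is read one
symbol per transition and is not stored. There are `tapes` work tapes, infinite in both directions,
over the finite alphabet `Symbol`, whose blank is `default`. At each transition the machine reads
one input symbol and the scanned work-tape symbols, changes state, and on each work tape writes a
symbol and then stays still (`none`) or moves one square left or right (`some`). -/
structure RealTimeMachine (A : Type u) where
  tapes : ℕ
  State : Type
  Symbol : Type
  [finiteState : Finite State]
  [finiteSymbol : Finite Symbol]
  [blank : Inhabited Symbol]
  start : State
  accept : Set State
  transition : State → A → (Fin tapes → Symbol) → State × (Fin tapes → Symbol × Option Turing.Dir)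

attribute [instance] RealTimeMachine.finiteState
attribute [instance] RealTimeMachine.finiteSymbol
attribute [instance] RealTimeMachine.blank

namespace RealTimeMachine

variable {A : Type u} (M : RealTimeMachine A)

/-- A configuration: the current state and the work tapes with their head positions. -/
abbrev Config : Type := M.State × (Fin M.tapes → Turing.Tape M.Symbol)

/-- The initial configuration: the start state, and all work tapes blank. -/
def init : M.Config := (M.start, fun _ => default)

/-- Stay still, or move one square. -/
def shift (m : Option Turing.Dir) (T : Turing.Tape M.Symbol) : Turing.Tape M.Symbol :=
  match m with
  | none => T
  | some d => T.move d

/-- One transition, reading the input symbol `a`. -/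
def step (c : M.Config) (a : A) : M.Config :=
  let r := M.transition c.1 a (fun i => (c.2 i).head)
  (r.1, fun i => M.shift (r.2 i).2 ((c.2 i).write (r.2 i).1))

/-- The configuration reached when the input `w` has been read. -/
def run (w : List A) : M.Config := w.foldl M.step M.init

/-- The accepted words: those at whose end the machine is in an accepting state. -/
def language : Language A := {w | (M.run w).1 ∈ M.accept}

end RealTimeMachine

/-- A real-time language: one accepted by a deterministic real-time Turing machine. -/
def IsRealTime {A : Type u} (L : Language A) : Prop :=
  ∃ M : RealTimeMachine A, M.language = L

/-! ### Words, geodesic length and the Cayley graph -/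

namespace Combing

noncomputable section

variable {G : Type u} [Group G]

/-- `X` is an inverse-closed (finite) generating set for the group. -/
structure IsGenSet (X : Finset G) : Prop where
  closure_eq : Subgroup.closure (X : Set G) = ⊤
  inv_mem : ∀ x ∈ X, x⁻¹ ∈ X

/-- The group element represented by a word over `X`. -/
def val {X : Finset G} (w : List X) : G := (w.map Subtype.val).prod

/-- The length of a shortest word over `X` representing `g`. -/
def geodLength (X : Finset G) (g : G) : ℕ :=
  sInf {n | ∃ w : List X, val w = g ∧ w.length = n}

/-- Distance between vertices of the Cayley graph, which has edges from `g` to `g * x`, `x ∈ X`. -/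
def vertexDist (X : Finset G) (g h : G) : ℕ := geodLength X (g⁻¹ * h)

/-- A point of the 1-skeleton of the Cayley graph: the point at distance `offset` from `src` along
the edge of length 1 from `src` to `tgt` (this edge is determined by `src` and `tgt`, its label
being `src⁻¹ * tgt`). The vertex `g` is the point with `src = tgt = g` and `offset = 0`. -/
structure SkelPoint (G : Type u) where
  src : G
  tgt : G
  offset : ℝ

/-- Length of a shortest route between two points that passes through an end of each of
their edges. -/
def viaDist (X : Finset G) (p q : SkelPoint G) : ℝ :=
  min (min (p.offset + vertexDist X p.src q.src + q.offset)
           (p.offset + vertexDist X p.src q.tgt + (1 - q.offset)))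
      (min ((1 - p.offset) + vertexDist X p.tgt q.src + q.offset)
           ((1 - p.offset) + vertexDist X p.tgt q.tgt + (1 - q.offset)))

open Classical in
/-- The path metric on the 1-skeleton: two points may be joined through ends of their edges and,
if they lie on the same edge (given with the same or with the opposite orientation),
also within that edge. -/
def skelDist (X : Finset G) (p q : SkelPoint G) : ℝ :=
  if p.src = q.src ∧ p.tgt = q.tgt then
    min |p.offset - q.offset| (viaDist X p q)
  else if p.src = q.tgt ∧ p.tgt = q.src then
    min |p.offset - (1 - q.offset)| (viaDist X p q)
  else viaDist X p q

/-- The path from `1` labelled by `w`, at unit speed, constant from time `w.length` on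
(and constant at negative times). -/
def wordPath {X : Finset G} (w : List X) (t : ℝ) : SkelPoint G where
  src := val (w.take ⌊t⌋₊)
  tgt := val (w.take (⌊t⌋₊ + 1))
  offset := if 0 ≤ t ∧ t < w.length then Int.fract t else 0

/-! ### Fellow-travelling -/

/-- `h` is a relative-speed function for words of lengths `m` and `n`. -/
structure IsRelativeSpeed (m n : ℕ) (h : ℝ → ℝ) : Prop where
  differentiable : Differentiable ℝ h
  strictMonoOn : StrictMonoOn h (Set.Icc 0 ((m : ℝ) + 1))
  image_eq : h '' Set.Icc 0 ((m : ℝ) + 1) = Set.Icc 0 ((n : ℝ) + 1)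

/-- `v` and `w` synchronously `K`-fellow-travel. -/
def SyncFellowTravel {X : Finset G} (K : ℕ) (v w : List X) : Prop :=
  ∀ t : ℝ, 0 < t → skelDist X (wordPath v t) (wordPath w t) ≤ K

/-- `v` and `w` asynchronously `K`-fellow-travel. -/
def AsyncFellowTravel {X : Finset G} (K : ℕ) (v w : List X) : Prop :=
  ∃ h : ℝ → ℝ, IsRelativeSpeed v.length w.length h ∧
    ∀ t : ℝ, 0 < t → skelDist X (wordPath v t) (wordPath w (h t)) ≤ K

/-- `v` and `w` boundedly asynchronously `K`-fellow-travel, with bound `M`. -/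
def BddAsyncFellowTravel {X : Finset G} (K : ℕ) (M : ℝ) (v w : List X) : Prop :=
  ∃ h : ℝ → ℝ, IsRelativeSpeed v.length w.length h ∧
    (∀ t : ℝ, 1 / M ≤ deriv h t ∧ deriv h t ≤ M) ∧
    ∀ t : ℝ, 0 < t → skelDist X (wordPath v t) (wordPath w (h t)) ≤ K

/-! ### Combings -/

/-- The three types of combing. -/
inductive Kind
  | synchronous
  | asynchronous
  | boundedlyAsynchronous

/-- `R v w` holds for all `v, w ∈ L` with `w = v x` in the group for some `x ∈ X ∪ {1}`. -/
def ForNeighbours {X : Finset G} (L : Language X) (R : List X → List X → Prop) : Prop :=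
  ∀ v ∈ L, ∀ w ∈ L, (val w = val v ∨ ∃ x ∈ X, val w = val v * x) → R v w

/-- The fellow-traveller condition on `L` for each type of combing. -/
def FellowTravels {X : Finset G} (L : Language X) : Kind → Prop
  | .synchronous => ∃ K : ℕ, ForNeighbours L (SyncFellowTravel K)
  | .asynchronous => ∃ K : ℕ, ForNeighbours L (AsyncFellowTravel K)
  | .boundedlyAsynchronous =>
      ∃ K : ℕ, ∃ M : ℝ, 0 < M ∧ ForNeighbours L (BddAsyncFellowTravel K M)

/-- `L` is a real-time combing of the given type for `G` over `X`: every element of `G` has a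
representative in `L`, `L` satisfies the fellow-traveller condition, and `L` is a
real-time language. -/
structure IsRealTimeCombing (kind : Kind) {X : Finset G} (L : Language X) : Prop where
  represents : ∀ g : G, ∃ w ∈ L, val w = g
  fellowTravels : FellowTravels L kind
  realTime : IsRealTime L

/-- `G` is real-time combable, with the given type of combing. -/
def RealTimeCombable (kind : Kind) (G : Type u) [Group G] : Prop :=
  ∃ X : Finset G, IsGenSet X ∧ ∃ L : Language X, IsRealTimeCombing kind L

/-- `f` is the length function of `L`: `f n` is the maximum length of a word in `L` of
geodesic length at most `n` (in particular these maxima exist). -/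
def IsLengthFunction {X : Finset G} (L : Language X) (f : ℕ → ℕ) : Prop :=
  ∀ n, IsGreatest {m | ∃ w ∈ L, geodLength X (val w) ≤ n ∧ w.length = m} (f n)

/-- `L` has a length function, which is bounded by a polynomial of degree `d`. -/
def LengthPolyBounded {X : Finset G} (L : Language X) (d : ℕ) : Prop :=
  ∃ f : ℕ → ℕ, IsLengthFunction L f ∧
    ∃ p : Polynomial ℝ, p.natDegree = d ∧ ∀ n : ℕ, (f n : ℝ) ≤ p.eval (n : ℝ)

end

end Combing

/-!
All the assertions are instances of two constructions for an injective homomorphism `φ : H →* G`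
onto a subgroup of finite index; a change of generators is the case `φ = id`. Let `ρ : G → H` be the
retraction with `ρ (φ h * g) = h * ρ g` given by a right transversal (`exists_isCosetRetraction`).
Both `φ` and `ρ` are Lipschitz for the word metrics.

* From `G` to `H` (`exists_combing_subgroup`): the words of the combing that represent elements of
  the subgroup are rewritten letter by letter in Schreier generators. After reading a prefix of `w`
  the new word represents the image of that prefix under `ρ`.
* From `H` to `G` (`exists_combing_of_subgroup`): the words of the combing are rewritten letter by
  letter through `φ`, and a word for an element of the transversal is appended.

In both cases the rewriting has to keep the language real-time and the fellow-travelling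
synchronous. This is achieved by a finite-state prefix code (`exists_prefix_code`): each codeword
begins with a header that represents `1` and identifies the encoded letter, and is padded so that
`n` letters are encoded by words of length `N * n` or `N * n + 1`. Parity obstructs codewords of one
fixed length, which is why the state of the encoder records an error in `{0, 1}`. A real-time
machine for the new language decodes its input with finitely many states and runs the given machine
whenever a codeword is complete (`isRealTime_encode`). The headers need two different generators;
a group generated by at most one self-inverse element has order at most two, and there the words of
bounded length form a combing (`exists_combing_of_geodLength_le`).

The new words then follow the images of the old paths at the constant speed `1 / N`, up to bounded
errors (`Tracks`), and words for neighbouring elements come from words for elements at bounded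
distance, which fellow-travel along a chain of neighbours (`travels_of_vertexDist_le`). Up to an
additive constant, fellow-travelling may be measured at the last visited vertices. A relative-speed
function `h` for the old words becomes one for the new words on conjugation by the linear maps
between the intervals of time (`IsTimeChange.exists_rescaled`), which differ from multiplication by
`N` by a bounded amount; the identity may be kept in the synchronous case. For the compositions in
a chain to be under control at all times, `h` is first made monotone on all of `ℝ` by following its
tangents outside its interval (`exists_monotone_eqOn_Icc`). Lengths change at most linearly
(`LengthPolyBounded.of_linear`).
-/

/-! ### Real-time languages and finite-state decoding -/

/-- Real-time languages are closed under inverse images by finite-state transducers that emit at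
most one letter for each letter read: `σ u` is the state and `g u` the output after reading `u`. The
machine stands still while nothing is emitted. Only the states that are reached need be finite in
number. -/
theorem IsRealTime.comap_transducer {A B S : Type*} {L : Language A} (hL : IsRealTime L)
    (σ : List B → S) (g : List B → List A) (δ : S → B → S × Option A)
    (hσ : ∀ u b, σ (u ++ [b]) = (δ (σ u) b).1) (hg_nil : g [] = [])
    (hg : ∀ u b, g (u ++ [b]) = g u ++ (δ (σ u) b).2.toList)
    (hfin : (Set.range σ).Finite) (F : Set S) :
    IsRealTime (A := B) {u | σ u ∈ F ∧ g u ∈ L} := by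
  obtain ⟨M, rfl⟩ := hL
  have := hfin.to_subtype
  obtain ⟨n, ⟨e⟩⟩ := Finite.exists_equiv_fin (Set.range σ)
  have hrange (s : Set.range σ) (b : B) : (δ s b).1 ∈ Set.range σ := by
    obtain ⟨_, u, rfl⟩ := s
    exact ⟨u ++ [b], hσ u b⟩
  let N : RealTimeMachine B :=
    { tapes := M.tapes
      State := M.State × Fin n
      Symbol := M.Symbol
      start := (M.start, e ⟨σ [], [], rfl⟩)
      accept := {s | s.1 ∈ M.accept ∧ (e.symm s.2 : S) ∈ F}
      transition := fun s b h =>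
        match (δ (e.symm s.2) b).2 with
        | none => ((s.1, e ⟨_, hrange (e.symm s.2) b⟩), fun i => (h i, none))
        | some a =>
          (((M.transition s.1 a h).1, e ⟨_, hrange (e.symm s.2) b⟩), (M.transition s.1 a h).2) }
  have key (u : List B) :
      N.run u = (((M.run (g u)).1, e ⟨σ u, u, rfl⟩), (M.run (g u)).2) := by
    induction u using List.reverseRecOn with
    | nil => simp [RealTimeMachine.run, hg_nil, RealTimeMachine.init, N]
    | append_singleton u b ih =>
      have hrun : N.run (u ++ [b]) = N.step (N.run u) b := by simp [RealTimeMachine.run]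
      have hstate : (⟨_, hrange ⟨σ u, u, rfl⟩ b⟩ : Set.range σ) = ⟨σ (u ++ [b]), _, rfl⟩ :=
        Subtype.ext (hσ u b).symm
      rw [hrun, ih, hg]
      rcases ho : (δ (σ u) b).2 with _ | a
      · simp [RealTimeMachine.step, N, ho, hstate, RealTimeMachine.shift, Turing.Tape.write_self]
      · have hMrun : M.run (g u ++ [a]) = M.step (M.run (g u)) a := by simp [RealTimeMachine.run]
        simp only [Option.toList_some, hMrun]
        simp [RealTimeMachine.step, N, ho, hstate, RealTimeMachine.shift]
  refine ⟨N, Set.ext fun u => ?_⟩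
  change (N.run u).1 ∈ N.accept ↔ σ u ∈ F ∧ (M.run (g u)).1 ∈ M.accept
  rw [key]
  simp [N, and_comm]

/-- The words of bounded length form a real-time language. -/
theorem isRealTime_length_le (B : Type*) (D : ℕ) :
    IsRealTime (A := B) {u | u.length ≤ D} := by
  let N : RealTimeMachine B :=
    { tapes := 0
      State := Fin (D + 2)
      Symbol := Unit
      start := 0
      accept := {s | s.val ≤ D}
      transition := fun s _ _ => (⟨min (s.val + 1) (D + 1), by omega⟩, fun i => i.elim0) }
  have key (u : List B) : (N.run u).1.val = min u.length (D + 1) := by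
    induction u using List.reverseRecOn with
    | nil => simp [RealTimeMachine.run, RealTimeMachine.init, N]
    | append_singleton u b ih =>
      have hrun : N.run (u ++ [b]) = N.step (N.run u) b := by simp [RealTimeMachine.run]
      rw [hrun]
      change min ((N.run u).1.val + 1) (D + 1) = _
      rw [ih, List.length_append, List.length_singleton]
      omega
  refine ⟨N, Set.ext fun u => ?_⟩
  change (N.run u).1.val ≤ D ↔ u.length ≤ D
  rw [key]
  omega

namespace Combing

/-- The word obtained from a word over `A` by a finite-state encoder: in state `q` the letter `a` is
replaced by the codeword `out q a`, and the state becomes `next q a`. -/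
def encode {Q A B : Type*} (next : Q → A → Q) (out : Q → A → List B) : Q → List A → List B
  | _, [] => []
  | q, a :: w => out q a ++ encode next out (next q a) w

section Encode

variable {Q A B : Type*} (next : Q → A → Q) (out : Q → A → List B)

theorem encode_append (q : Q) (u v : List A) :
    encode next out q (u ++ v) =
      encode next out q u ++ encode next out (u.foldl next q) v := by
  induction u generalizing q with
  | nil => rfl
  | cons a u ih => simp [encode, ih]

theorem encode_concat (q : Q) (u : List A) (a : A) :
    encode next out q (u ++ [a]) = encode next out q u ++ out (u.foldl next q) a := by
  simp [encode_append, encode]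

open Classical in
/-- One step of the decoder for `encode`. Its state is the state of the encoder with the part of
the current codeword read so far, or `none` if no encoded word starts with the input. -/
noncomputable def decodeStep (s : Option (Q × List B)) (b : B) :
    Option (Q × List B) × Option A :=
  match s with
  | none => (none, none)
  | some (q, p) =>
    if h : ∃ a, out q a = p ++ [b] then (some (next q h.choose, []), some h.choose)
    else if ∃ a, p ++ [b] <+: out q a then (some (q, p ++ [b]), none)
    else (none, none)

/-- The decoder for `encode`: its state, and the letters decoded so far. -/
noncomputable def decode (q₀ : Q) (u : List B) : Option (Q × List B) × List A :=
  u.foldl (fun s b => ((decodeStep next out s.1 b).1, s.2 ++ (decodeStep next out s.1 b).2.toList))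
    (some (q₀, []), [])

theorem decode_concat (q₀ : Q) (u : List B) (b : B) :
    decode next out q₀ (u ++ [b]) =
      ((decodeStep next out (decode next out q₀ u).1 b).1,
        (decode next out q₀ u).2 ++ (decodeStep next out (decode next out q₀ u).1 b).2.toList) := by
  simp [decode]

/-- While the decoder has not failed, the input is the encoding of the letters decoded so far
followed by the unfinished codeword. -/
theorem encode_of_decode (q₀ : Q) (u : List B) (q : Q) (p : List B)
    (h : (decode next out q₀ u).1 = some (q, p)) :
    u = encode next out q₀ (decode next out q₀ u).2 ++ p ∧
      q = (decode next out q₀ u).2.foldl next q₀ := by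
  induction u using List.reverseRecOn generalizing q p with
  | nil =>
    obtain ⟨rfl, rfl⟩ : q₀ = q ∧ [] = p := by simpa [decode] using h
    simp [decode, encode]
  | append_singleton u b ih =>
    rw [decode_concat] at h ⊢
    rcases hs : (decode next out q₀ u).1 with _ | ⟨q₁, p₁⟩
    · simp [hs, decodeStep] at h
    · obtain ⟨hu, hq⟩ := ih q₁ p₁ hs
      by_cases h₁ : ∃ a, out q₁ a = p₁ ++ [b]
      · have hstep : decodeStep next out (some (q₁, p₁)) b =
            (some (next q₁ h₁.choose, []), some h₁.choose) := by
          simp only [decodeStep, dif_pos h₁]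
        simp only [hs, hstep, Option.some.injEq, Prod.mk.injEq] at h ⊢
        obtain ⟨rfl, rfl⟩ := h
        have hc := h₁.choose_spec
        simp only [Option.toList_some, encode_concat, ← hq, hc, List.foldl_append, List.foldl_cons,
          List.foldl_nil, List.append_nil, and_true]
        rw [← List.append_assoc, ← hu]
      · by_cases h₂ : ∃ a, p₁ ++ [b] <+: out q₁ a
        · have hstep : decodeStep next out (some (q₁, p₁)) b =
              (some (q₁, p₁ ++ [b]), (none : Option A)) := by
            simp only [decodeStep, dif_neg h₁, if_pos h₂]
          simp only [hs, hstep, Option.some.injEq, Prod.mk.injEq] at h ⊢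
          obtain ⟨rfl, rfl⟩ := h
          simp only [Option.toList_none, List.append_nil]
          rw [← List.append_assoc, ← hu]
          exact ⟨rfl, hq⟩
        · simp [hs, decodeStep, dif_neg h₁, if_neg h₂] at h

/-- A prefix code is decoded correctly. -/
theorem decode_encode (hprefix : ∀ q a a', out q a <+: out q a' → a = a')
    (hne : ∀ q a, out q a ≠ []) (q₀ : Q) (w : List A) :
    decode next out q₀ (encode next out q₀ w) = (some (w.foldl next q₀, []), w) := by
  classical
  induction w using List.reverseRecOn with
  | nil => rfl
  | append_singleton w a ih =>
    set q := w.foldl next q₀ with hq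
    have aux (p : List B) (hp : p <+: out q a) :
        decode next out q₀ (encode next out q₀ w ++ p) =
          if p = out q a then (some (next q a, []), w ++ [a]) else (some (q, p), w) := by
      induction p using List.reverseRecOn with
      | nil => rw [if_neg (hne q a).symm, List.append_nil, ih]
      | append_singleton p b ihp =>
        have hpp : p <+: out q a := (List.prefix_append p [b]).trans hp
        have hpne : p ≠ out q a := by
          rintro rfl
          simpa using hp.length_le
        rw [← List.append_assoc, decode_concat, ihp hpp, if_neg hpne]
        by_cases h₁ : ∃ a', out q a' = p ++ [b]
        · have hc := h₁.choose_spec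
          have ha : h₁.choose = a := hprefix q _ _ (by rwa [hc])
          have hstep : decodeStep next out (some (q, p)) b = (some (next q a, []), some a) := by
            simp only [decodeStep, dif_pos h₁, ha]
          rw [ha] at hc
          simp [hstep, hc]
        · have hstep : decodeStep next out (some (q, p)) b =
              (some (q, p ++ [b]), (none : Option A)) := by
            simp only [decodeStep, dif_neg h₁, if_pos (⟨a, hp⟩ : ∃ a, p ++ [b] <+: out q a)]
          have hpb : p ++ [b] ≠ out q a := fun h => h₁ ⟨a, h.symm⟩
          simp [hstep, hpb]
    rw [encode_concat, ← hq, aux _ List.prefix_rfl, if_pos rfl]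
    simp [hq]

theorem finite_range_decode [Finite Q] [Finite A] (q₀ : Q) :
    (Set.range fun u => (decode next out q₀ u).1).Finite := by
  let P : Set (Q × List B) := ⋃ q : Q, ⋃ a : A, {q} ×ˢ {p | p ∈ (out q a).inits}
  have hP : P.Finite := Set.finite_iUnion fun q => Set.finite_iUnion fun a =>
    (Set.finite_singleton q).prod (List.finite_toSet _)
  let E : Set (Option (Q × List B)) :=
    {none} ∪ some '' (P ∪ (Set.range fun q : Q => (q, ([] : List B))))
  have hE : E.Finite :=
    (Set.finite_singleton _).union ((hP.union (Set.finite_range _)).image _)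
  refine hE.subset ?_
  rintro _ ⟨u, rfl⟩
  have hnil (q : Q) : some (q, []) ∈ E := Or.inr ⟨_, Or.inr ⟨q, rfl⟩, rfl⟩
  induction u using List.reverseRecOn with
  | nil => exact hnil q₀
  | append_singleton u b ih =>
    simp only [decode_concat]
    rcases (decode next out q₀ u).1 with _ | ⟨q, p⟩
    · exact Or.inl rfl
    · simp only [decodeStep]
      split_ifs with h₁ h₂
      · exact hnil _
      · obtain ⟨a, ha⟩ := h₂
        refine Or.inr ⟨_, Or.inl ?_, rfl⟩
        simp only [P, Set.mem_iUnion]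
        exact ⟨q, a, rfl, by simpa using ha⟩
      · exact Or.inl rfl

/-- The encodings of a real-time language by a finite-state prefix code form a real-time language.
Here some letters may be auxiliary (those with `e a = none`), and the final state is prescribed. -/
theorem isRealTime_encode [Finite Q] [Finite A]
    (hprefix : ∀ q a a', out q a <+: out q a' → a = a') (hne : ∀ q a, out q a ≠ [])
    (q₀ : Q) (F : Set Q) {C : Type*} {L : Language C} (hL : IsRealTime L) (e : A → Option C) :
    IsRealTime (A := B)
      {u | ∃ w : List A, encode next out q₀ w = u ∧ w.foldl next q₀ ∈ F ∧ w.filterMap e ∈ L} := by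
  have := hL.comap_transducer (fun u => (decode next out q₀ u).1)
    (fun u => (decode next out q₀ u).2.filterMap e)
    (fun s b => ((decodeStep next out s b).1, (decodeStep next out s b).2.bind e))
    (fun u b => by simp [decode_concat]) (by simp [decode])
    (fun u b => by
      simp only [decode_concat, List.filterMap_append]
      rcases (decodeStep next out (decode next out q₀ u).1 b).2 with _ | a
      · simp
      · rcases h : e a <;> simp [h])
    (finite_range_decode next out q₀) {s | ∃ q ∈ F, s = some (q, [])}
  refine (congrArg IsRealTime (Set.ext fun u => ⟨?_, ?_⟩)).mpr this
  · rintro ⟨w, rfl, hF, hw⟩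
    have := decode_encode next out hprefix hne q₀ w
    exact ⟨⟨_, hF, by rw [this]⟩, by rw [this]; exact hw⟩
  · rintro ⟨⟨q, hq, hs⟩, hw⟩
    obtain ⟨hu, rfl⟩ := encode_of_decode next out q₀ u q [] hs
    exact ⟨_, by rw [List.append_nil] at hu; exact hu.symm, hq, hw⟩

end Encode

end Combing

/-! ### The word metric -/

namespace Combing

section WordMetric

variable {G : Type u} [Group G] {X : Finset G}

@[simp] theorem val_nil : val ([] : List X) = 1 := rfl

@[simp] theorem val_cons (x : X) (w : List X) : val (x :: w) = x * val w := by simp [val]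

@[simp] theorem val_append (v w : List X) : val (v ++ w) = val v * val w := by simp [val]

theorem val_inv_reverse (hX : IsGenSet X) (w : List X) :
    val (w.reverse.map fun x : X => (⟨(x : G)⁻¹, hX.inv_mem _ x.2⟩ : X)) = (val w)⁻¹ := by
  induction w with
  | nil => simp
  | cons x w ih =>
    rw [List.reverse_cons, List.map_append, val_append, ih]
    simp

theorem IsGenSet.exists_word (hX : IsGenSet X) (g : G) : ∃ w : List X, val w = g := by
  have hg : g ∈ Subgroup.closure (X : Set G) := hX.closure_eq ▸ Subgroup.mem_top g
  induction hg using Subgroup.closure_induction with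
  | mem x hx => exact ⟨[⟨x, hx⟩], by simp⟩
  | one => exact ⟨[], rfl⟩
  | mul x y _ _ hx hy =>
    obtain ⟨v, rfl⟩ := hx
    obtain ⟨w, rfl⟩ := hy
    exact ⟨v ++ w, val_append v w⟩
  | inv x _ hx =>
    obtain ⟨v, rfl⟩ := hx
    exact ⟨_, val_inv_reverse hX v⟩

theorem geodLength_val_le (w : List X) : geodLength X (val w) ≤ w.length :=
  Nat.sInf_le ⟨w, rfl, rfl⟩

theorem IsGenSet.exists_geodesic (hX : IsGenSet X) (g : G) :
    ∃ w : List X, val w = g ∧ w.length = geodLength X g := by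
  obtain ⟨w, hw⟩ := hX.exists_word g
  exact Nat.sInf_mem (s := {n | ∃ w : List X, val w = g ∧ w.length = n}) ⟨_, w, hw, rfl⟩

theorem geodLength_one : geodLength X (1 : G) = 0 :=
  Nat.le_zero.mp (geodLength_val_le ([] : List X))

theorem geodLength_mem_le {x : G} (hx : x ∈ X) : geodLength X x ≤ 1 := by
  simpa using geodLength_val_le [(⟨x, hx⟩ : X)]

theorem IsGenSet.geodLength_mul_le (hX : IsGenSet X) (g h : G) :
    geodLength X (g * h) ≤ geodLength X g + geodLength X h := by
  obtain ⟨v, rfl, hv⟩ := hX.exists_geodesic g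
  obtain ⟨w, rfl, hw⟩ := hX.exists_geodesic h
  rw [← hv, ← hw, ← val_append, ← List.length_append]
  exact geodLength_val_le _

theorem IsGenSet.geodLength_inv_le (hX : IsGenSet X) (g : G) :
    geodLength X g⁻¹ ≤ geodLength X g := by
  obtain ⟨v, rfl, hv⟩ := hX.exists_geodesic g
  rw [← val_inv_reverse hX, ← hv]
  exact (geodLength_val_le _).trans (by simp)

theorem vertexDist_self (g : G) : vertexDist X g g = 0 := by
  rw [vertexDist, inv_mul_cancel, geodLength_one]

theorem vertexDist_one_left (g : G) : vertexDist X 1 g = geodLength X g := by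
  rw [vertexDist, inv_one, one_mul]

theorem IsGenSet.vertexDist_comm (hX : IsGenSet X) (g h : G) :
    vertexDist X g h = vertexDist X h g := by
  have key (g h : G) : vertexDist X g h ≤ vertexDist X h g := by
    simpa [vertexDist] using hX.geodLength_inv_le (h⁻¹ * g)
  exact le_antisymm (key g h) (key h g)

theorem IsGenSet.vertexDist_triangle (hX : IsGenSet X) (g h k : G) :
    vertexDist X g k ≤ vertexDist X g h + vertexDist X h k := by
  simpa [vertexDist, mul_assoc] using hX.geodLength_mul_le (g⁻¹ * h) (h⁻¹ * k)

/-- A map that moves the ends of each edge a bounded distance apart is Lipschitz. -/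
theorem IsGenSet.vertexDist_map_le (hX : IsGenSet X) {H : Type u} [Group H] {Y : Finset H}
    (hY : IsGenSet Y) {ψ : G → H} {c : ℕ}
    (hψ : ∀ g, ∀ x ∈ X, vertexDist Y (ψ g) (ψ (g * x)) ≤ c) (g h : G) :
    vertexDist Y (ψ g) (ψ h) ≤ c * vertexDist X g h := by
  obtain ⟨w, hw, hlen⟩ := hX.exists_geodesic (g⁻¹ * h)
  rw [vertexDist, vertexDist, ← hlen]
  obtain rfl : h = g * val w := by rw [hw, mul_inv_cancel_left]
  clear hw hlen
  induction w generalizing g with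
  | nil => simp [geodLength_one]
  | cons x w ih =>
    refine (hY.vertexDist_triangle _ (ψ (g * x)) _).trans ?_
    have h₁ := hψ g x x.2
    have h₂ := ih (g * x)
    rw [mul_assoc, ← val_cons] at h₂
    rw [List.length_cons, mul_add, mul_one, add_comm (c * _)]
    exact add_le_add h₁ h₂

theorem vertexDist_take_le (w : List X) {i j : ℕ} (hij : i ≤ j) :
    vertexDist X (val (w.take i)) (val (w.take j)) ≤ j - i := by
  obtain ⟨k, rfl⟩ := Nat.exists_eq_add_of_le hij
  rw [List.take_add, vertexDist, val_append, inv_mul_cancel_left]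
  refine (geodLength_val_le _).trans ?_
  rw [List.length_take]
  omega

theorem IsGenSet.vertexDist_take_le_of_le (hX : IsGenSet X) (w : List X) {i j c : ℕ}
    (hij : i ≤ j + c) (hji : j ≤ i + c) :
    vertexDist X (val (w.take i)) (val (w.take j)) ≤ c := by
  rcases le_total i j with h | h
  · exact (vertexDist_take_le w h).trans (by omega)
  · rw [hX.vertexDist_comm]
    exact (vertexDist_take_le w h).trans (by omega)

/-! ### Fellow-travelling measured between vertices -/

/-- The last vertex that the path of `w` has visited at time `t`. -/
noncomputable def lastVertex (w : List X) (t : ℝ) : G := val (w.take ⌊t⌋₊)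

theorem lastVertex_of_length_le (w : List X) {t : ℝ} (ht : (w.length : ℝ) ≤ t) :
    lastVertex w t = val w := by
  rw [lastVertex, List.take_of_length_le (Nat.le_floor ht)]

theorem offset_wordPath_mem (w : List X) (t : ℝ) :
    0 ≤ (wordPath w t).offset ∧ (wordPath w t).offset ≤ 1 := by
  simp only [wordPath]
  split_ifs
  · exact ⟨Int.fract_nonneg t, (Int.fract_lt_one t).le⟩
  · norm_num

theorem vertexDist_wordPath_le (w : List X) (t : ℝ) :
    vertexDist X (wordPath w t).src (wordPath w t).tgt ≤ 1 :=
  (vertexDist_take_le w (Nat.le_succ ⌊t⌋₊)).trans (by omega)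

theorem skelDist_wordPath_le (v w : List X) (s t : ℝ) :
    skelDist X (wordPath v s) (wordPath w t) ≤
      vertexDist X (lastVertex v s) (lastVertex w t) + 2 := by
  have hvia : viaDist X (wordPath v s) (wordPath w t) ≤
      vertexDist X (lastVertex v s) (lastVertex w t) + 2 := by
    have h : viaDist X (wordPath v s) (wordPath w t) ≤ (wordPath v s).offset +
        vertexDist X (lastVertex v s) (lastVertex w t) + (wordPath w t).offset :=
      (min_le_left _ _).trans (min_le_left _ _)
    linarith [(offset_wordPath_mem v s).2, (offset_wordPath_mem w t).2]
  rw [skelDist]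
  split_ifs
  · exact (min_le_right _ _).trans hvia
  · exact (min_le_right _ _).trans hvia
  · exact hvia

theorem IsGenSet.vertexDist_lastVertex_le (hX : IsGenSet X) (v w : List X) (s t : ℝ) :
    (vertexDist X (lastVertex v s) (lastVertex w t) : ℝ) ≤
      skelDist X (wordPath v s) (wordPath w t) + 2 := by
  change (vertexDist X (wordPath v s).src (wordPath w t).src : ℝ) ≤ _
  have hp := vertexDist_wordPath_le v s
  have hq := vertexDist_wordPath_le w t
  have hpo := offset_wordPath_mem v s
  have hqo := offset_wordPath_mem w t
  revert hp hq hpo hqo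
  generalize wordPath v s = p
  generalize wordPath w t = q
  intro hp hq hpo hqo
  have htri₁ (g : G) : (vertexDist X g q.src : ℝ) ≤ vertexDist X g q.tgt + 1 := by
    rw [hX.vertexDist_comm] at hq
    exact_mod_cast (hX.vertexDist_triangle g q.tgt q.src).trans (by gcongr)
  have htri₂ (g : G) : (vertexDist X p.src g : ℝ) ≤ vertexDist X p.tgt g + 1 := by
    exact_mod_cast (hX.vertexDist_triangle p.src p.tgt g).trans (by rw [add_comm]; gcongr)
  have hvia : (vertexDist X p.src q.src : ℝ) - 2 ≤ viaDist X p q := by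
    refine le_min (le_min ?_ ?_) (le_min ?_ ?_)
    · linarith
    · linarith [htri₁ p.src]
    · linarith [htri₂ q.src]
    · linarith [htri₁ p.src, htri₂ q.tgt]
  rw [← sub_le_iff_le_add, skelDist]
  split_ifs with h₁ h₂
  · refine le_min ?_ hvia
    have := abs_nonneg (p.offset - q.offset)
    rw [h₁.1, vertexDist_self]
    push_cast
    linarith
  · refine le_min ?_ hvia
    have := abs_nonneg (p.offset - (1 - q.offset))
    have h := htri₁ p.src
    rw [h₂.1, vertexDist_self] at h
    rw [h₂.1]
    push_cast at h
    linarith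
  · exact hvia

end WordMetric

/-! ### Changes of time -/

/-- Replacing a differentiable function beyond a point by another one with the same value and
derivative there gives a differentiable function. -/
theorem differentiable_ite_le {f g : ℝ → ℝ} (hf : Differentiable ℝ f) (hg : Differentiable ℝ g)
    {b : ℝ} (h : f b = g b) (h' : deriv f b = deriv g b) :
    Differentiable ℝ fun t => if t ≤ b then f t else g t := by
  intro t
  rcases lt_trichotomy t b with ht | rfl | ht
  · refine (hf t).congr_of_eventuallyEq ?_
    filter_upwards [Iio_mem_nhds ht] with s hs
    exact if_pos (le_of_lt hs)
  · have hl : HasDerivWithinAt (fun s => if s ≤ t then f s else g s) (deriv f t) (Set.Iic t) t :=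
      (hf t).hasDerivAt.hasDerivWithinAt.congr (fun s hs => if_pos hs) (if_pos le_rfl)
    have hr : HasDerivWithinAt (fun s => if s ≤ t then f s else g s) (deriv f t) (Set.Ici t) t := by
      rw [h']
      refine (hg t).hasDerivAt.hasDerivWithinAt.congr (fun s hs => ?_) ((if_pos le_rfl).trans h)
      rcases (Set.mem_Ici.mp hs).eq_or_lt with rfl | hs
      · exact (if_pos le_rfl).trans h
      · exact if_neg (not_le.mpr hs)
    have := hl.union hr
    rw [Set.Iic_union_Ici, hasDerivWithinAt_univ] at this
    exact this.differentiableAt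
  · refine (hg t).congr_of_eventuallyEq ?_
    filter_upwards [Ioi_mem_nhds ht] with s hs
    exact if_neg (not_le.mpr hs)

theorem deriv_nonneg_of_monotoneOn_Icc {h : ℝ → ℝ} (hd : Differentiable ℝ h) {a b c : ℝ}
    (hab : a < b) (hmono : MonotoneOn h (Set.Icc a b)) (hc : c ∈ Set.Icc a b) : 0 ≤ deriv h c := by
  rw [← (hd c).derivWithin (uniqueDiffOn_Icc hab c hc)]
  exact hmono.derivWithin_nonneg

/-- A differentiable function that is monotone on an interval can be changed outside the interval,
to its tangents at the ends, so as to become monotone everywhere. -/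
theorem exists_monotone_eqOn_Icc {h : ℝ → ℝ} (hd : Differentiable ℝ h) {a b : ℝ} (hab : a < b)
    (hmono : MonotoneOn h (Set.Icc a b)) :
    ∃ k : ℝ → ℝ, Differentiable ℝ k ∧ Monotone k ∧ Set.EqOn k h (Set.Icc a b) := by
  have hda := deriv_nonneg_of_monotoneOn_Icc hd hab hmono (Set.left_mem_Icc.mpr hab.le)
  have hdb := deriv_nonneg_of_monotoneOn_Icc hd hab hmono (Set.right_mem_Icc.mpr hab.le)
  let tangent (c t : ℝ) : ℝ := h c + deriv h c * (t - c)
  have htd (c : ℝ) : Differentiable ℝ (tangent c) := by fun_prop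
  have htderiv (c : ℝ) : deriv (tangent c) c = deriv h c := by
    simp only [tangent, deriv_const_add']
    rw [deriv_const_mul _ (by fun_prop)]
    simp
  have htmono (c : ℝ) (hc : 0 ≤ deriv h c) : Monotone (tangent c) := fun s t hst => by
    simp only [tangent]
    gcongr
  have htc (c : ℝ) : tangent c c = h c := by simp [tangent]
  let k₁ (t : ℝ) : ℝ := if t ≤ b then h t else tangent b t
  have hk₁d : Differentiable ℝ k₁ :=
    differentiable_ite_le hd (htd b) (htc b).symm (htderiv b).symm
  have hk₁h (t : ℝ) (ht : t ≤ b) : k₁ t = h t := if_pos ht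
  have hk₁t (t : ℝ) (ht : b ≤ t) : k₁ t = tangent b t := by
    rcases ht.eq_or_lt with rfl | ht
    · rw [hk₁h _ le_rfl, htc]
    · exact if_neg (not_le.mpr ht)
  have hk₁deriv : deriv k₁ a = deriv h a := by
    refine Filter.EventuallyEq.deriv_eq ?_
    filter_upwards [Iio_mem_nhds hab] with t ht
    exact hk₁h t (le_of_lt ht)
  let k (t : ℝ) : ℝ := if t ≤ a then tangent a t else k₁ t
  have hkt (t : ℝ) (ht : t ≤ a) : k t = tangent a t := if_pos ht
  have hkk₁ (t : ℝ) (ht : a ≤ t) : k t = k₁ t := by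
    rcases ht.eq_or_lt with rfl | ht
    · rw [hkt _ le_rfl, htc, hk₁h _ hab.le]
    · exact if_neg (not_le.mpr ht)
  refine ⟨k, differentiable_ite_le (htd a) hk₁d ?_ ?_, ?_, ?_⟩
  · rw [htc, hk₁h _ hab.le]
  · rw [htderiv, hk₁deriv]
  · refine MonotoneOn.Iic_union_Ici (a := a) ?_ ?_
    · exact ((htmono a hda).monotoneOn _).congr fun t ht => (hkt t ht).symm
    · refine MonotoneOn.congr (f₁ := k₁) ?_ fun t ht => (hkk₁ t ht).symm
      rw [← Set.Icc_union_Ici_eq_Ici hab.le]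
      refine MonotoneOn.union_right (c := b) ?_ ?_ (isGreatest_Icc hab.le) isLeast_Ici
      · exact hmono.congr fun t ht => (hk₁h t ht.2).symm
      · exact ((htmono b hdb).monotoneOn _).congr fun t ht => (hk₁t t ht).symm
  · intro t ht
    rw [hkk₁ t ht.1, hk₁h t ht.2]

namespace IsRelativeSpeed

variable {m n k : ℕ} {h : ℝ → ℝ}

theorem mapsTo (hh : IsRelativeSpeed m n h) :
    Set.MapsTo h (Set.Icc 0 ((m : ℝ) + 1)) (Set.Icc 0 ((n : ℝ) + 1)) :=
  Set.mapsTo_iff_image_subset.mpr hh.image_eq.subset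

theorem map_zero (hh : IsRelativeSpeed m n h) : h 0 = 0 := by
  have h0 : (0 : ℝ) ∈ Set.Icc 0 ((m : ℝ) + 1) := ⟨le_rfl, by positivity⟩
  obtain ⟨t, ht, hht⟩ := hh.image_eq.superset (⟨le_rfl, by positivity⟩ : (0 : ℝ) ∈ Set.Icc 0 _)
  exact le_antisymm (hht ▸ hh.strictMonoOn.monotoneOn h0 ht ht.1) (hh.mapsTo h0).1

theorem map_length_add_one (hh : IsRelativeSpeed m n h) : h (m + 1) = n + 1 := by
  have hm : (m : ℝ) + 1 ∈ Set.Icc 0 ((m : ℝ) + 1) := ⟨by positivity, le_rfl⟩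
  obtain ⟨t, ht, hht⟩ :=
    hh.image_eq.superset (⟨by positivity, le_rfl⟩ : (n : ℝ) + 1 ∈ Set.Icc 0 _)
  exact le_antisymm (hh.mapsTo hm).2 (hht ▸ hh.strictMonoOn.monotoneOn ht hm ht.2)

theorem comp {g : ℝ → ℝ} (hg : IsRelativeSpeed n k g) (hh : IsRelativeSpeed m n h) :
    IsRelativeSpeed m k (g ∘ h) where
  differentiable := hg.differentiable.comp hh.differentiable
  strictMonoOn := hg.strictMonoOn.comp hh.strictMonoOn hh.mapsTo
  image_eq := by rw [Set.image_comp, hh.image_eq, hg.image_eq]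

theorem exists_monotone (hh : IsRelativeSpeed m n h) :
    ∃ k, IsRelativeSpeed m n k ∧ Monotone k ∧ Set.EqOn k h (Set.Icc 0 ((m : ℝ) + 1)) := by
  obtain ⟨k, hkd, hkm, hkh⟩ := exists_monotone_eqOn_Icc hh.differentiable
    (by positivity : (0 : ℝ) < m + 1) hh.strictMonoOn.monotoneOn
  exact ⟨k, ⟨hkd, hh.strictMonoOn.congr hkh.symm, by rw [hkh.image_eq, hh.image_eq]⟩, hkm, hkh⟩

theorem pos_of_monotone (hh : IsRelativeSpeed m n h) (hmono : Monotone h) {t : ℝ} (ht : 0 < t) :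
    0 < h t := by
  have hs : 0 < min t ((m : ℝ) + 1) := lt_min ht (by positivity)
  have := hh.strictMonoOn ⟨le_rfl, by positivity⟩ ⟨hs.le, min_le_right _ _⟩ hs
  rw [hh.map_zero] at this
  exact this.trans_le (hmono (min_le_left _ _))

end IsRelativeSpeed

/-- The change of time that rescales `[0, m + 1]` linearly to `[0, n + 1]`. -/
noncomputable def rescale (m n : ℕ) (t : ℝ) : ℝ := ((n : ℝ) + 1) / (m + 1) * t

theorem rescale_isRelativeSpeed (m n : ℕ) : IsRelativeSpeed m n (rescale m n) where
  differentiable := by unfold rescale; fun_prop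
  strictMonoOn := fun s _ t _ hst => by unfold rescale; gcongr
  image_eq := by
    unfold rescale
    have hpos : (0 : ℝ) < ((n : ℝ) + 1) / (m + 1) := by positivity
    rw [Set.image_mul_left_Icc' hpos, mul_zero, div_mul_cancel₀ _ (by positivity)]

theorem rescale_monotone (m n : ℕ) : Monotone (rescale m n) := fun s t hst => by
  unfold rescale
  gcongr

theorem deriv_rescale (m n : ℕ) (t : ℝ) : deriv (rescale m n) t = ((n : ℝ) + 1) / (m + 1) := by
  exact ((hasDerivAt_id t).const_mul (((n : ℝ) + 1) / (m + 1))).deriv.trans (mul_one _)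

/-- The changes of time allowed for each type of combing, between words of lengths `m` and `n`. For
asynchronous combings monotonicity is required on all of `ℝ`, so that compositions are controlled
at all times; `M` is relevant only to boundedly asynchronous combings. -/
def IsTimeChange (M : ℝ) (m n : ℕ) (h : ℝ → ℝ) : Kind → Prop
  | .synchronous => h = id
  | .asynchronous => IsRelativeSpeed m n h ∧ Monotone h
  | .boundedlyAsynchronous =>
      IsRelativeSpeed m n h ∧ ∀ t : ℝ, 1 / M ≤ deriv h t ∧ deriv h t ≤ M

namespace IsTimeChange

variable {kind : Kind} {M M' : ℝ} {m n k : ℕ} {h g : ℝ → ℝ}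

theorem pos (hM : 0 < M) (hh : IsTimeChange M m n h kind) {t : ℝ} (ht : 0 < t) : 0 < h t := by
  cases kind with
  | synchronous => rw [show h = id from hh]; exact ht
  | asynchronous => exact hh.1.pos_of_monotone hh.2 ht
  | boundedlyAsynchronous =>
    exact hh.1.pos_of_monotone (monotone_of_deriv_nonneg hh.1.differentiable
      fun t => (by positivity : 0 ≤ 1 / M).trans (hh.2 t).1) ht

theorem comp (hM : 0 < M) (hM' : 0 < M') (hg : IsTimeChange M' n k g kind)
    (hh : IsTimeChange M m n h kind) : IsTimeChange (M' * M) m k (g ∘ h) kind := by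
  cases kind with
  | synchronous => rw [show h = id from hh, show g = id from hg]; rfl
  | asynchronous => exact ⟨hg.1.comp hh.1, hg.2.comp hh.2⟩
  | boundedlyAsynchronous =>
    refine ⟨hg.1.comp hh.1, fun t => ?_⟩
    rw [deriv_comp _ (hg.1.differentiable _) (hh.1.differentiable _), one_div, mul_inv,
      ← one_div, ← one_div]
    have h₁ := hg.2 (h t)
    have h₂ := hh.2 t
    have hp : 0 < 1 / M := by positivity
    have hp' : 0 < 1 / M' := by positivity
    exact ⟨mul_le_mul h₁.1 h₂.1 hp.le (hp'.le.trans h₁.1),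
      mul_le_mul h₁.2 h₂.2 (hp.le.trans h₂.1) hM'.le⟩

end IsTimeChange

theorem deriv_rescale_bounds {m n c : ℕ} (hm : m + 1 ≤ c * (n + 1)) (hn : n + 1 ≤ c * (m + 1))
    (t : ℝ) : 1 / (c : ℝ) ≤ deriv (rescale m n) t ∧ deriv (rescale m n) t ≤ c := by
  have hc : (0 : ℝ) < c := by
    rcases Nat.eq_zero_or_pos c with rfl | hc
    · omega
    · exact_mod_cast hc
  rw [deriv_rescale, div_le_div_iff₀ hc (by positivity), div_le_iff₀ (by positivity), one_mul,
    mul_comm _ (c : ℝ)]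
  exact ⟨by exact_mod_cast hm, by exact_mod_cast hn⟩

end Combing

namespace Combing

/-! ### The fellow-traveller condition in terms of vertices -/

section Travels

variable {G : Type u} [Group G] {X : Finset G} {L : Language X} {kind : Kind}

/-- After the change of time `h`, the last visited vertices of `v` and `w` stay within distance `K`,
where `h` is a change of time of the given type, with bound `M`. -/
def Travels (kind : Kind) (K : ℕ) (M : ℝ) (v w : List X) : Prop :=
  ∃ h : ℝ → ℝ, IsTimeChange M v.length w.length h kind ∧
    ∀ t : ℝ, 0 < t → vertexDist X (lastVertex v t) (lastVertex w (h t)) ≤ K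

theorem Travels.trans (hX : IsGenSet X) {K K' : ℕ} {M M' : ℝ} (hM : 0 < M) (hM' : 0 < M')
    {u v w : List X} (huv : Travels kind K M u v) (hvw : Travels kind K' M' v w) :
    Travels kind (K + K') (M' * M) u w := by
  obtain ⟨h, hh, hK⟩ := huv
  obtain ⟨g, hg, hK'⟩ := hvw
  exact ⟨g ∘ h, hg.comp hM hM' hh, fun t ht =>
    (hX.vertexDist_triangle _ _ _).trans (add_le_add (hK t ht) (hK' (h t) (hh.pos hM ht)))⟩

theorem IsGenSet.forNeighbours_travels (hX : IsGenSet X) (hL : FellowTravels L kind) :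
    ∃ (K : ℕ) (M : ℝ), 0 < M ∧ ForNeighbours L (Travels kind K M) := by
  have hvertex (K : ℕ) (v w : List X) (s t : ℝ)
      (h : skelDist X (wordPath v s) (wordPath w t) ≤ K) :
      vertexDist X (lastVertex v s) (lastVertex w t) ≤ K + 2 := by
    exact_mod_cast (hX.vertexDist_lastVertex_le v w s t).trans (add_le_add_left h 2)
  cases kind with
  | synchronous =>
    obtain ⟨K, hK⟩ := hL
    exact ⟨K + 2, 1, one_pos, fun v hv w hw hvw =>
      ⟨id, rfl, fun t ht => hvertex K v w t t (hK v hv w hw hvw t ht)⟩⟩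
  | asynchronous =>
    obtain ⟨K, hK⟩ := hL
    refine ⟨K + 2, 1, one_pos, fun v hv w hw hvw => ?_⟩
    obtain ⟨h, hh, hhK⟩ := hK v hv w hw hvw
    obtain ⟨k, hk, hmono, hkh⟩ := hh.exists_monotone
    refine ⟨k, ⟨hk, hmono⟩, fun t ht => ?_⟩
    rcases le_total t (v.length + 1) with htv | htv
    · rw [hkh ⟨ht.le, htv⟩]
      exact hvertex K v w t (h t) (hhK t ht)
    · have h₁ := hvertex K v w _ _ (hhK (v.length + 1) (by positivity))
      have h₂ := hmono htv
      rw [hk.map_length_add_one] at h₂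
      rw [hh.map_length_add_one, lastVertex_of_length_le _ (by linarith),
        lastVertex_of_length_le _ (by linarith)] at h₁
      rwa [lastVertex_of_length_le _ (by linarith), lastVertex_of_length_le _ (by linarith)]
  | boundedlyAsynchronous =>
    obtain ⟨K, M, hM, hK⟩ := hL
    refine ⟨K + 2, M, hM, fun v hv w hw hvw => ?_⟩
    obtain ⟨h, hh, hder, hhK⟩ := hK v hv w hw hvw
    exact ⟨h, ⟨hh, hder⟩, fun t ht => hvertex K v w t (h t) (hhK t ht)⟩

theorem fellowTravels_of_travels {K : ℕ} {M : ℝ} (hM : 0 < M)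
    (hL : ForNeighbours L (Travels kind K M)) : FellowTravels L kind := by
  have hskel (v w : List X) (s t : ℝ)
      (h : vertexDist X (lastVertex v s) (lastVertex w t) ≤ K) :
      skelDist X (wordPath v s) (wordPath w t) ≤ (K + 2 : ℕ) := by
    refine (skelDist_wordPath_le v w s t).trans ?_
    exact_mod_cast add_le_add_left h 2
  cases kind with
  | synchronous =>
    refine ⟨K + 2, fun v hv w hw hvw t ht => hskel v w t t ?_⟩
    obtain ⟨h, hh, hhK⟩ := hL v hv w hw hvw
    obtain rfl : h = id := hh
    exact hhK t ht
  | asynchronous =>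
    refine ⟨K + 2, fun v hv w hw hvw => ?_⟩
    obtain ⟨h, hh, hhK⟩ := hL v hv w hw hvw
    exact ⟨h, hh.1, fun t ht => hskel v w t (h t) (hhK t ht)⟩
  | boundedlyAsynchronous =>
    refine ⟨K + 2, M, hM, fun v hv w hw hvw => ?_⟩
    obtain ⟨h, hh, hhK⟩ := hL v hv w hw hvw
    exact ⟨h, hh.1, hh.2, fun t ht => hskel v w t (h t) (hhK t ht)⟩

/-- In a combing, words that represent elements at bounded distance fellow-travel: they are joined
by a chain of neighbouring words of bounded length. -/
theorem travels_of_vertexDist_le (hX : IsGenSet X) (hrep : ∀ g : G, ∃ w ∈ L, val w = g) {K : ℕ}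
    {M : ℝ} (hM : 0 < M) (hL : ForNeighbours L (Travels kind K M)) (r : ℕ) :
    ∃ (K' : ℕ) (M' : ℝ), 0 < M' ∧ ∀ v ∈ L, ∀ w ∈ L, vertexDist X (val v) (val w) ≤ r →
      Travels kind K' M' v w := by
  induction r with
  | zero =>
    refine ⟨K, M, hM, fun v hv w hw hvw => hL v hv w hw (Or.inl ?_)⟩
    obtain ⟨z, hz, hlen⟩ := hX.exists_geodesic ((val v)⁻¹ * val w)
    obtain rfl : z = [] := List.eq_nil_of_length_eq_zero (hlen.trans (Nat.le_zero.mp hvw))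
    exact (inv_mul_eq_one.mp hz.symm).symm
  | succ r ih =>
    obtain ⟨K', M', hM', hK'⟩ := ih
    refine ⟨K + K', M' * M, mul_pos hM' hM, fun v hv w hw hvw => ?_⟩
    obtain ⟨z, hz, hlen⟩ := hX.exists_geodesic ((val v)⁻¹ * val w)
    have hzr : z.length ≤ r + 1 := hlen.trans_le hvw
    -- The first step of the geodesic, or no step at all if it is trivial.
    obtain ⟨u, hu, huv, hur⟩ : ∃ u ∈ L, (val u = val v ∨ ∃ x ∈ X, val u = val v * x) ∧
        vertexDist X (val u) (val w) ≤ r := by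
      rcases z with _ | ⟨x, z⟩
      · refine ⟨v, hv, Or.inl rfl, ?_⟩
        rw [vertexDist, ← hz]
        exact (geodLength_val_le _).trans (Nat.zero_le r)
      · obtain ⟨u, hu, hux⟩ := hrep (val v * x)
        refine ⟨u, hu, Or.inr ⟨x, x.2, hux⟩, ?_⟩
        have : (val u)⁻¹ * val w = val z := by
          rw [val_cons] at hz
          rw [hux, mul_inv_rev, mul_assoc, ← hz, inv_mul_cancel_left]
        rw [vertexDist, this]
        exact (geodLength_val_le z).trans (by simpa using hzr)
    exact (hL v hv u hu huv).trans hX hM hM' (hK' u hu w hw hur)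

end Travels

/-! ### Words that track one another -/

section Tracks

variable {G H : Type u} [Group G] [Group H] {X : Finset G} {Y : Finset H}

/-- The path of `v` follows the image under `ψ` of the path of `w`, slowed down by the factor `N`,
up to errors of at most `C` in time and in space. -/
structure Tracks (N C : ℕ) (ψ : G → H) (w : List X) (v : List Y) : Prop where
  length_le : v.length ≤ N * w.length + C
  le_length : N * w.length ≤ v.length + C
  near : ∀ i ≤ w.length, ∃ j, j ≤ N * i + C ∧ N * i ≤ j + C ∧
    vertexDist Y (val (v.take j)) (ψ (val (w.take i))) ≤ C

theorem floor_min_bounds {t : ℝ} (ht : 0 ≤ t) (n : ℕ) :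
    ((min ⌊t⌋₊ n : ℕ) : ℝ) ≤ min t (n + 1) ∧ min t ((n : ℝ) + 1) ≤ ((min ⌊t⌋₊ n : ℕ) : ℝ) + 1 := by
  have h₁ := Nat.floor_le ht
  have h₂ := Nat.lt_floor_add_one t
  push_cast
  constructor
  · exact min_le_min h₁ (by linarith)
  · rw [← min_add_add_right]
    exact min_le_min h₂.le le_rfl

/-- The truncation of both times by `min` accounts for the paths having come to rest. -/
theorem Tracks.vertexDist_lastVertex_le (hY : IsGenSet Y) {N C : ℕ} {ψ : G → H} {w : List X}
    {v : List Y} (h : Tracks N C ψ w v) {s t : ℝ} (hs : 0 ≤ s) (ht : 0 ≤ t)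
    (hst : |min t ((v.length : ℝ) + 1) - N * min s ((w.length : ℝ) + 1)| ≤ N + C + 1) :
    vertexDist Y (lastVertex v t) (ψ (lastVertex w s)) ≤ 2 * N + 3 * C + 2 := by
  obtain ⟨hs₁, hs₂⟩ := floor_min_bounds hs w.length
  obtain ⟨ht₁, ht₂⟩ := floor_min_bounds ht v.length
  rw [lastVertex, lastVertex, List.take_eq_take_min (l := v), List.take_eq_take_min (l := w)]
  obtain ⟨j, hj₁, hj₂, hj⟩ := h.near _ (min_le_right ⌊s⌋₊ w.length)
  generalize min ⌊s⌋₊ w.length = i at *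
  generalize min ⌊t⌋₊ v.length = k at *
  rw [abs_le] at hst
  have hN : (0 : ℝ) ≤ N := Nat.cast_nonneg N
  have hNi₁ := mul_le_mul_of_nonneg_left hs₁ hN
  have hNi₂ := mul_le_mul_of_nonneg_left hs₂ hN
  have hk₁ : k ≤ N * i + (2 * N + C + 1) := by
    have : (k : ℝ) ≤ N * i + (2 * N + C + 1) := by linarith
    exact_mod_cast this
  have hk₂ : N * i ≤ k + (N + C + 2) := by
    have : (N * i : ℝ) ≤ k + (N + C + 2) := by linarith
    exact_mod_cast this
  refine (hY.vertexDist_triangle _ (val (v.take j)) _).trans ?_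
  have := hY.vertexDist_take_le_of_le v (i := k) (j := j) (c := 2 * N + 2 * C + 2)
    (by omega) (by omega)
  omega

theorem rescale_pos (m n : ℕ) {t : ℝ} (ht : 0 < t) : 0 < rescale m n t := by
  unfold rescale
  positivity

theorem rescale_rescale (m n : ℕ) (t : ℝ) : rescale n m (rescale m n t) = t := by
  unfold rescale
  field_simp

theorem abs_length_sub_le {m n N C : ℕ} (hmn : m ≤ N * n + C) (hnm : N * n ≤ m + C) :
    |((m : ℝ) + 1) - N * (n + 1)| ≤ N + C + 1 := by
  have hmn' : (m : ℝ) ≤ N * n + C := by exact_mod_cast hmn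
  have hnm' : (N * n : ℝ) ≤ m + C := by exact_mod_cast hnm
  have hN : (0 : ℝ) ≤ N := Nat.cast_nonneg N
  have hC : (0 : ℝ) ≤ C := Nat.cast_nonneg C
  rw [abs_le]
  constructor <;> linarith

theorem abs_min_sub_rescale_le {m n N C : ℕ} (hmn : m ≤ N * n + C) (hnm : N * n ≤ m + C) {t : ℝ}
    (ht : 0 < t) :
    |min t ((m : ℝ) + 1) - N * min (rescale m n t) ((n : ℝ) + 1)| ≤ N + C + 1 := by
  have hm : (0 : ℝ) < (m : ℝ) + 1 := by positivity
  have hmin : min (rescale m n t) ((n : ℝ) + 1) = ((n : ℝ) + 1) / (m + 1) * min t (m + 1) := by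
    rw [mul_min_of_nonneg _ _ (by positivity), div_mul_cancel₀ _ hm.ne', rescale]
  have hq : min t ((m : ℝ) + 1) / (m + 1) ≤ 1 := (div_le_one hm).mpr (min_le_right _ _)
  have hq₀ : 0 ≤ min t ((m : ℝ) + 1) / (m + 1) := div_nonneg (le_min ht.le hm.le) hm.le
  have heq : min t ((m : ℝ) + 1) - N * (((n : ℝ) + 1) / (m + 1) * min t (m + 1)) =
      min t ((m : ℝ) + 1) / (m + 1) * ((m + 1) - N * (n + 1)) := by
    field_simp
  rw [hmin, heq, abs_mul, abs_of_nonneg hq₀]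
  exact (mul_le_of_le_one_left (abs_nonneg _) hq).trans (abs_length_sub_le hmn hnm)

/-- A change of time between words of lengths `m` and `n` gives one between words that are `N` times
as long, up to an additive error: it is conjugated by linear rescalings, or kept if it is the
identity. -/
theorem IsTimeChange.exists_rescaled {kind : Kind} {N C : ℕ} (hN : 1 ≤ N) {M : ℝ} (hM : 0 < M) :
    ∃ M' : ℝ, 0 < M' ∧ ∀ {m n m' n' : ℕ}, m' ≤ N * m + C → N * m ≤ m' + C → n' ≤ N * n + C →
      N * n ≤ n' + C → ∀ {h : ℝ → ℝ}, IsTimeChange M m n h kind →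
        ∃ h' : ℝ → ℝ, IsTimeChange M' m' n' h' kind ∧ ∀ t, 0 < t → ∃ s, 0 < s ∧ 0 < h' t ∧
          |min t ((m' : ℝ) + 1) - N * min s ((m : ℝ) + 1)| ≤ N + C + 1 ∧
          |min (h' t) ((n' : ℝ) + 1) - N * min (h s) ((n : ℝ) + 1)| ≤ N + C + 1 := by
  have hcpos : (0 : ℝ) < (N + C + 1 : ℕ) := by positivity
  refine ⟨(N + C + 1 : ℕ) * (M * (N + C + 1 : ℕ)), by positivity, ?_⟩
  intro m n m' n' hm hm' hn hn' h hh
  -- The lengths `k'` and `k` are comparable up to a constant factor.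
  have hfactor {k k' : ℕ} (h₁ : k' ≤ N * k + C) (h₂ : N * k ≤ k' + C) :
      k' + 1 ≤ (N + C + 1) * (k + 1) ∧ k + 1 ≤ (N + C + 1) * (k' + 1) := by
    have := Nat.le_mul_of_pos_left k hN
    constructor <;> nlinarith
  have hscale (a b : ℕ) (h₁ : a + 1 ≤ (N + C + 1) * (b + 1)) (h₂ : b + 1 ≤ (N + C + 1) * (a + 1))
      (hk : kind ≠ .synchronous) : IsTimeChange (N + C + 1 : ℕ) a b (rescale a b) kind := by
    cases kind with
    | synchronous => exact absurd rfl hk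
    | asynchronous => exact ⟨rescale_isRelativeSpeed a b, rescale_monotone a b⟩
    | boundedlyAsynchronous => exact ⟨rescale_isRelativeSpeed a b, deriv_rescale_bounds h₁ h₂⟩
  obtain ⟨hm₁, hm₂⟩ := hfactor hm hm'
  obtain ⟨hn₁, hn₂⟩ := hfactor hn hn'
  by_cases hk : kind = .synchronous
  · subst hk
    obtain rfl : h = id := hh
    have hNpos : (0 : ℝ) < N := by exact_mod_cast hN
    have hclose (t : ℝ) {k k' : ℕ} (h₁ : k' ≤ N * k + C) (h₂ : N * k ≤ k' + C) :
        |min t ((k' : ℝ) + 1) - N * min (t / N) ((k : ℝ) + 1)| ≤ N + C + 1 := by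
      rw [mul_min_of_nonneg _ _ hNpos.le, mul_div_cancel₀ _ hNpos.ne']
      refine (abs_min_sub_min_le_max _ _ _ _).trans ?_
      rw [sub_self, abs_zero]
      exact max_le (by positivity) (abs_length_sub_le h₁ h₂)
    exact ⟨id, rfl, fun t ht =>
      ⟨t / N, div_pos ht hNpos, ht, hclose t hm hm', hclose t hn hn'⟩⟩
  · refine ⟨rescale n n' ∘ (h ∘ rescale m' m),
      (hscale n n' hn₂ hn₁ hk).comp (by positivity) hcpos
        (hh.comp hcpos hM (hscale m' m hm₁ hm₂ hk)), fun t ht => ?_⟩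
    have hs := rescale_pos m' m ht
    have ht' := rescale_pos n n' (hh.pos hM hs)
    refine ⟨rescale m' m t, hs, ht', abs_min_sub_rescale_le hm hm' ht, ?_⟩
    have := abs_min_sub_rescale_le hn hn' ht'
    rwa [rescale_rescale] at this

/-- The fellow-traveller condition passes from a combing `L` to a language whose words track those
of `L`, provided that `ψ` is Lipschitz and that the tracked words depend on the elements
represented in a Lipschitz way, through `ψ'`. -/
theorem fellowTravels_of_tracks (hX : IsGenSet X) (hY : IsGenSet Y) {ψ : G → H} {ψ' : H → G}
    {c c' : ℕ} (hψ : ∀ g g', vertexDist Y (ψ g) (ψ g') ≤ c * vertexDist X g g')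
    (hψ' : ∀ h h', vertexDist X (ψ' h) (ψ' h') ≤ c' * vertexDist Y h h') {N C : ℕ} (hN : 1 ≤ N)
    {kind : Kind} {L : Language X} (hrep : ∀ g : G, ∃ w ∈ L, val w = g)
    (hL : FellowTravels L kind) {L' : Language Y}
    (hL' : ∀ v ∈ L', ∃ w ∈ L, val w = ψ' (val v) ∧ Tracks N C ψ w v) :
    FellowTravels L' kind := by
  obtain ⟨K, M, hM, hK⟩ := hX.forNeighbours_travels hL
  obtain ⟨K', M', hM', hK'⟩ := travels_of_vertexDist_le hX hrep hM hK c'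
  obtain ⟨M'', hM'', hscale⟩ := IsTimeChange.exists_rescaled (kind := kind) (C := C) hN hM'
  refine fellowTravels_of_travels (K := (2 * N + 3 * C + 2) + c * K' + (2 * N + 3 * C + 2)) hM'' ?_
  intro v₁ hv₁ v₂ hv₂ hv
  obtain ⟨w₁, hw₁, hval₁, ht₁⟩ := hL' v₁ hv₁
  obtain ⟨w₂, hw₂, hval₂, ht₂⟩ := hL' v₂ hv₂
  have hd : vertexDist Y (val v₁) (val v₂) ≤ 1 := by
    rcases hv with hv | ⟨y, hy, hv⟩
    · rw [hv, vertexDist_self]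
      exact zero_le_one
    · rw [hv, vertexDist, inv_mul_cancel_left]
      exact geodLength_mem_le hy
  have hw : vertexDist X (val w₁) (val w₂) ≤ c' := by
    rw [hval₁, hval₂]
    exact (hψ' _ _).trans (by nlinarith)
  obtain ⟨h, hh, hhK⟩ := hK' w₁ hw₁ w₂ hw₂ hw
  obtain ⟨h', hh', hclose⟩ :=
    hscale ht₁.length_le ht₁.le_length ht₂.length_le ht₂.le_length hh
  refine ⟨h', hh', fun t ht => ?_⟩
  obtain ⟨s, hs, ht', hc₁, hc₂⟩ := hclose t ht
  have h₁ := ht₁.vertexDist_lastVertex_le hY hs.le ht.le hc₁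
  have h₂ := ht₂.vertexDist_lastVertex_le hY (hh.pos hM' hs).le ht'.le hc₂
  rw [hY.vertexDist_comm] at h₂
  have h₃ := (hψ (lastVertex w₁ s) (lastVertex w₂ (h s))).trans
    (Nat.mul_le_mul_left c (hhK s hs))
  refine (hY.vertexDist_triangle _ (ψ (lastVertex w₂ (h s))) _).trans (add_le_add ?_ h₂)
  exact (hY.vertexDist_triangle _ (ψ (lastVertex w₁ s)) _).trans (add_le_add h₁ h₃)

end Tracks

/-! ### Length functions -/

section LengthFunction

variable {G H : Type u} [Group G] [Group H] {X : Finset G} {Y : Finset H}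

/-- A language that contains a representative of `1` has a length function as soon as the lengths
of its words are bounded in terms of the geodesic lengths. -/
theorem exists_isLengthFunction {L : Language X} (hone : ∃ w ∈ L, val w = 1) {F : ℕ → ℕ}
    (hF : ∀ n, ∀ w ∈ L, geodLength X (val w) ≤ n → w.length ≤ F n) :
    ∃ f : ℕ → ℕ, IsLengthFunction L f ∧ ∀ n, f n ≤ F n := by
  obtain ⟨w₀, hw₀, hone⟩ := hone
  have hne (n : ℕ) : {m | ∃ w ∈ L, geodLength X (val w) ≤ n ∧ w.length = m}.Nonempty :=
    ⟨_, w₀, hw₀, by rw [hone, geodLength_one]; exact Nat.zero_le n, rfl⟩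
  have hub (n : ℕ) : F n ∈ upperBounds {m | ∃ w ∈ L, geodLength X (val w) ≤ n ∧ w.length = m} := by
    rintro _ ⟨w, hw, hn, rfl⟩
    exact hF n w hw hn
  exact ⟨fun n => sSup {m | ∃ w ∈ L, geodLength X (val w) ≤ n ∧ w.length = m},
    fun n => ⟨Nat.sSup_mem (hne n) ⟨_, hub n⟩, fun m hm => le_csSup ⟨_, hub n⟩ hm⟩,
    fun n => csSup_le (hne n) (hub n)⟩

theorem LengthPolyBounded.of_linear {L : Language X} {L' : Language Y} {d : ℕ}
    (hL : LengthPolyBounded L d) (hone : ∃ v ∈ L', val v = 1) {N C c : ℕ} (hN : 1 ≤ N) (hc : 1 ≤ c)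
    (hL' : ∀ v ∈ L', ∃ w ∈ L, geodLength X (val w) ≤ c * geodLength Y (val v) + C ∧
      v.length ≤ N * w.length + C) : LengthPolyBounded L' d := by
  obtain ⟨f, hf, p, hp, hfp⟩ := hL
  obtain ⟨f', hf', hle⟩ := exists_isLengthFunction hone (F := fun n => N * f (c * n + C) + C)
    fun n v hv hn => by
      obtain ⟨w, hw, hwv, hlen⟩ := hL' v hv
      refine hlen.trans ?_
      gcongr
      exact (hf (c * n + C)).2 ⟨w, hw, hwv.trans (by gcongr), rfl⟩
  refine ⟨f', hf', Polynomial.C (N : ℝ) *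
    p.comp (Polynomial.C (c : ℝ) * Polynomial.X + Polynomial.C (C : ℝ)) +
      Polynomial.C (C : ℝ), ?_, fun n => ?_⟩
  · have hN' : (N : ℝ) ≠ 0 := by exact_mod_cast (by omega : N ≠ 0)
    have hc' : (c : ℝ) ≠ 0 := by exact_mod_cast (by omega : c ≠ 0)
    rw [Polynomial.natDegree_add_C, Polynomial.natDegree_C_mul hN', Polynomial.natDegree_comp,
      Polynomial.natDegree_linear hc', mul_one, hp]
  · have h₁ : (f' n : ℝ) ≤ N * f (c * n + C) + C := by exact_mod_cast hle n
    have h₂ := hfp (c * n + C)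
    simp only [Polynomial.eval_add, Polynomial.eval_mul, Polynomial.eval_C, Polynomial.eval_comp,
      Polynomial.eval_X]
    push_cast at h₂
    refine h₁.trans ?_
    gcongr

theorem lengthPolyBounded_of_length_le {L : Language X} (hone : ∃ w ∈ L, val w = 1) {D : ℕ}
    (hD : ∀ w ∈ L, w.length ≤ D) (d : ℕ) : LengthPolyBounded L d := by
  obtain ⟨f, hf, hle⟩ := exists_isLengthFunction hone (F := fun _ => D) fun n w hw _ => hD w hw
  refine ⟨f, hf, Polynomial.X ^ d + Polynomial.C (D : ℝ), Polynomial.natDegree_X_pow_add_C,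
    fun n => ?_⟩
  have : (f n : ℝ) ≤ D := by exact_mod_cast hle n
  simp only [Polynomial.eval_add, Polynomial.eval_pow, Polynomial.eval_X, Polynomial.eval_C]
  have : (0 : ℝ) ≤ (n : ℝ) ^ d := by positivity
  linarith

/-- In a group of finite diameter, the words of length at most the diameter form a combing. -/
theorem exists_combing_of_geodLength_le (hX : IsGenSet X) {D : ℕ} (hD : ∀ g, geodLength X g ≤ D)
    (kind : Kind) :
    ∃ L : Language X, IsRealTimeCombing kind L ∧ ∀ d, LengthPolyBounded L d := by
  have hrep (g : G) : ∃ w ∈ ({w | w.length ≤ D} : Set (List X)), val w = g := by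
    obtain ⟨w, hw, hlen⟩ := hX.exists_geodesic g
    exact ⟨w, hlen.trans_le (hD g), hw⟩
  refine ⟨{w | w.length ≤ D}, ⟨hrep, ?_, isRealTime_length_le X D⟩,
    lengthPolyBounded_of_length_le (hrep 1) fun w hw => hw⟩
  refine fellowTravels_of_travels (K := D) (M := (D + 1 : ℕ)) (by positivity) ?_
  intro v hv w hw _
  have hbound {m n : ℕ} (hm : m ≤ D) : m + 1 ≤ (D + 1) * (n + 1) := by nlinarith
  cases kind with
  | synchronous => exact ⟨id, rfl, fun t _ => hD _⟩
  | asynchronous =>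
    exact ⟨_, ⟨rescale_isRelativeSpeed _ _, rescale_monotone _ _⟩, fun t _ => hD _⟩
  | boundedlyAsynchronous =>
    exact ⟨_, ⟨rescale_isRelativeSpeed _ _, deriv_rescale_bounds (hbound hv) (hbound hw)⟩,
      fun t _ => hD _⟩

end LengthFunction

end Combing

namespace Combing

/-! ### Codewords representing prescribed elements -/

section Codewords

variable {G : Type u} [Group G] {X : Finset G}

/-- A word representing `1` that records a sequence of bits: the bit `false` is written `x x⁻¹` and
the bit `true` is written `y y⁻¹`. -/
def bitWord (hX : IsGenSet X) (x y : X) (l : List Bool) : List X :=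
  l.flatMap fun b =>
    [if b then y else x, ⟨((if b then y else x : X) : G)⁻¹, hX.inv_mem _ (Subtype.property _)⟩]

theorem bitWord_cons (hX : IsGenSet X) (x y : X) (b : Bool) (l : List Bool) :
    bitWord hX x y (b :: l) = (if b then y else x) ::
      ⟨((if b then y else x : X) : G)⁻¹, hX.inv_mem _ (Subtype.property _)⟩ :: bitWord hX x y l :=
  rfl

theorem val_bitWord (hX : IsGenSet X) (x y : X) (l : List Bool) : val (bitWord hX x y l) = 1 := by
  induction l with
  | nil => rfl
  | cons b l ih =>
    rw [bitWord_cons, val_cons, val_cons, ih]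
    simp

theorem length_bitWord (hX : IsGenSet X) (x y : X) (l : List Bool) : (bitWord hX x y l).length = 2 * l.length := by
  simp [bitWord, List.length_flatMap, mul_comm]

theorem bitWord_injective (hX : IsGenSet X) {x y : X} (hxy : x ≠ y) : Function.Injective (bitWord hX x y) := by
  intro l
  induction l with
  | nil =>
    intro l' h
    have := congrArg List.length h
    simp only [length_bitWord, List.length_nil] at this
    exact (List.eq_nil_of_length_eq_zero (by omega)).symm
  | cons b l ih =>
    intro l' h
    rcases l' with _ | ⟨b', l'⟩
    · have := congrArg List.length h
      simp [length_bitWord] at this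
    · rw [bitWord_cons, bitWord_cons, List.cons.injEq, List.cons.injEq] at h
      obtain ⟨hb, -, hl⟩ := h
      rw [ih hl]
      congr 1
      cases b <;> cases b' <;> simp_all [hxy.symm]

/-- Over a generating set with two elements there is a finite-state prefix code whose codewords
represent prescribed elements and which is synchronous up to an error of one letter. A codeword
consists of a header that identifies the encoded letter, a word for the prescribed element, and
padding. The padding changes the length by even numbers only, hence codewords of odd length may be
unavoidable; the second component of the state keeps the accumulated error in `{0, 1}`. -/
theorem exists_prefix_code (hX : IsGenSet X) {x y : X} (hxy : x ≠ y) {A Q : Type*} [Finite A]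
    [Finite Q] (next : Q → A → Q) (el : Q → A → G) :
    ∃ (N : ℕ) (next' : Q × Fin 2 → A → Q × Fin 2) (out : Q × Fin 2 → A → List X), 1 ≤ N ∧
      (∀ q a, (next' q a).1 = next q.1 a) ∧ (∀ q a, val (out q a) = el q.1 a) ∧
      (∀ q a, (out q a).length + q.2.val = N + (next' q a).2.val) ∧
      (∀ q a a', out q a <+: out q a' → a = a') ∧ ∀ q a, out q a ≠ [] := by
  choose word hword using hX.exists_word
  obtain ⟨m, hm⟩ := (Set.finite_range fun s : Q × A => (word (el s.1 s.2)).length).bddAbove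
  have hm' (q : Q) (a : A) : (word (el q a)).length ≤ m := hm ⟨(q, a), rfl⟩
  obtain ⟨k, ⟨e⟩⟩ := Finite.exists_equiv_fin A
  let header (a : A) : List X := bitWord hX x y (List.ofFn fun i : Fin k => decide (i = e a))
  have hheader (a : A) : (header a).length = 2 * k := by simp [header, length_bitWord]
  have hinj (a a' : A) (h : header a = header a') : a = a' := by
    have := congrFun (List.ofFn_injective (bitWord_injective hX hxy h)) (e a)
    simpa using this
  -- `N₀` is even and exceeds all the lengths, so that the padding needed below is nonnegative and
  -- of even length.
  let N₀ : ℕ := 2 * (m + 1)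
  let err (q : Q × Fin 2) (a : A) : Fin 2 :=
    ⟨((word (el q.1 a)).length + q.2.val) % 2, Nat.mod_lt _ two_pos⟩
  let pad (q : Q × Fin 2) (a : A) : List X := bitWord hX x y (List.replicate
    ((N₀ + (err q a).val - q.2.val - (word (el q.1 a)).length) / 2) false)
  let out (q : Q × Fin 2) (a : A) : List X := header a ++ (word (el q.1 a) ++ pad q a)
  have hlen (q : Q × Fin 2) (a : A) :
      (out q a).length + q.2.val = 2 * k + N₀ + (err q a).val := by
    have h₁ := hm' q.1 a
    have h₂ := q.2.isLt
    simp only [out, List.length_append, hheader, pad, length_bitWord, List.length_replicate,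
      err, N₀]
    omega
  refine ⟨2 * k + N₀, fun q a => (next q.1 a, err q a), out, by omega, fun _ _ => rfl,
    fun q a => by simp [out, header, pad, val_bitWord, hword], hlen, fun q a a' h => ?_,
    fun q a h => ?_⟩
  · refine hinj a a' (List.IsPrefix.eq_of_length ?_ ((hheader a).trans (hheader a').symm))
    exact List.prefix_of_prefix_length_le ((List.prefix_append _ _).trans h)
      (List.prefix_append _ _) ((hheader a).trans (hheader a').symm).le
  · have h₁ := hlen q a
    have h₂ := q.2.isLt
    rw [h, List.length_nil] at h₁
    omega

/-- The encoding defined by `exists_prefix_code`: its time distortion, the elements represented, and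
its compatibility with real-time acceptance. -/
theorem exists_realTime_encoding (hX : IsGenSet X) {x y : X} (hxy : x ≠ y) {A Q : Type*}
    [Finite A] [Finite Q] (next : Q → A → Q) (el : Q → A → G) (q₀ : Q) :
    ∃ (N : ℕ) (code : List A → List X), 1 ≤ N ∧
      (∀ w, N * w.length ≤ (code w).length ∧ (code w).length ≤ N * w.length + 1) ∧
      (∀ u v, u <+: v → code u <+: code v) ∧ val (code []) = 1 ∧
      (∀ w a, val (code (w ++ [a])) = val (code w) * el (w.foldl next q₀) a) ∧
      ∀ {C : Type u} {L : Language C}, IsRealTime L → ∀ (F : Set Q) (e : A → Option C),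
        IsRealTime (A := X)
          {v | ∃ w, code w = v ∧ w.foldl next q₀ ∈ F ∧ w.filterMap e ∈ L} := by
  obtain ⟨N, next', out, hN, hnext, hval, hlen, hprefix, hne⟩ :=
    exists_prefix_code hX hxy next el
  have hfold (w : List A) : (w.foldl next' (q₀, 0)).1 = w.foldl next q₀ := by
    induction w using List.reverseRecOn with
    | nil => rfl
    | append_singleton w a ih => simp [hnext, ih]
  have hlength (w : List A) :
      (encode next' out (q₀, 0) w).length = N * w.length + (w.foldl next' (q₀, 0)).2.val := by
    induction w using List.reverseRecOn with
    | nil => rfl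
    | append_singleton w a ih =>
      have := hlen (w.foldl next' (q₀, 0)) a
      simp only [encode_concat, List.length_append, List.length_singleton, List.foldl_append,
        List.foldl_cons, List.foldl_nil, mul_add]
      omega
  refine ⟨N, encode next' out (q₀, 0), hN, fun w => ?_, ?_, rfl, fun w a => ?_, ?_⟩
  · have := (w.foldl next' (q₀, 0)).2.isLt
    rw [hlength]
    omega
  · rintro u _ ⟨v, rfl⟩
    rw [encode_append]
    exact List.prefix_append _ _
  · rw [encode_concat, val_append, hval, hfold]
  · intro C L hL F e
    have := isRealTime_encode next' out hprefix hne (q₀, 0) (Prod.fst ⁻¹' F) hL e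
    simpa only [Set.mem_preimage, hfold] using this

/-- A generating set with at most one element gives a group of order at most two. -/
theorem geodLength_le_one_of_subsingleton (hX : IsGenSet X) (h : ∀ x y : X, x = y) (g : G) :
    geodLength X g ≤ 1 := by
  obtain ⟨w, rfl, hlen⟩ := hX.exists_geodesic g
  rcases w with _ | ⟨a, _ | ⟨b, w⟩⟩
  · rw [← hlen]
    simp
  · rw [← hlen]
    simp
  · -- The first two letters cancel, so that the word is not geodesic.
    have hab : (b : G) = (a : G)⁻¹ := congrArg Subtype.val (h b ⟨_, hX.inv_mem _ a.2⟩)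
    have : geodLength X (val (a :: b :: w)) ≤ w.length := by
      rw [val_cons, val_cons, hab, mul_inv_cancel_left]
      exact geodLength_val_le w
    simp only [List.length_cons] at hlen
    omega

end Codewords

/-! ### Passing to and from a subgroup of finite index -/

section FiniteIndex

variable {G H : Type u} [Group G] [Group H] {X : Finset G} {Y : Finset H}

/-- Tracking holds without error in space if the images of the vertices of `w` are represented by
prefixes of `v` of nearly the right lengths. -/
theorem Tracks.of_prefixes {N C : ℕ} (hC : 1 ≤ C) {ψ : G → H} {w : List X} {v : List Y}
    (h₁ : v.length ≤ N * w.length + C) (h₂ : N * w.length ≤ v.length)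
    (h : ∀ i ≤ w.length, ∃ p, p <+: v ∧ N * i ≤ p.length ∧ p.length ≤ N * i + 1 ∧
      val p = ψ (val (w.take i))) : Tracks N C ψ w v where
  length_le := h₁
  le_length := h₂.trans (Nat.le_add_right _ _)
  near := fun i hi => by
    obtain ⟨p, hp, hp₁, hp₂, hval⟩ := h i hi
    refine ⟨p.length, by omega, by omega, ?_⟩
    rw [← List.prefix_iff_eq_take.mp hp, hval, vertexDist_self]
    exact Nat.zero_le C

/-- A real-time language whose words track those of a real-time combing is a real-time combing, with
a length function of the same growth. -/
theorem isRealTimeCombing_of_tracks (hX : IsGenSet X) (hY : IsGenSet Y) {ψ : G → H} {ψ' : H → G}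
    (hψ : ∃ c, ∀ g g', vertexDist Y (ψ g) (ψ g') ≤ c * vertexDist X g g')
    (hψ' : ∃ c, ∀ h h', vertexDist X (ψ' h) (ψ' h') ≤ c * vertexDist Y h h') (hone : ψ' 1 = 1)
    {N C : ℕ} (hN : 1 ≤ N) {kind : Kind} {L : Language X} (hL : IsRealTimeCombing kind L)
    {L' : Language Y} (hrep : ∀ h : H, ∃ v ∈ L', val v = h) (hrt : IsRealTime L')
    (hL' : ∀ v ∈ L', ∃ w ∈ L, val w = ψ' (val v) ∧ Tracks N C ψ w v) :
    IsRealTimeCombing kind L' ∧ ∀ d, LengthPolyBounded L d → LengthPolyBounded L' d := by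
  obtain ⟨c, hc⟩ := hψ
  obtain ⟨c', hc'⟩ := hψ'
  refine ⟨⟨hrep, fellowTravels_of_tracks hX hY hc hc' hN hL.represents hL.fellowTravels hL', hrt⟩,
    fun d hd => hd.of_linear (hrep 1) hN (Nat.le_add_left 1 c') (C := C) fun v hv => ?_⟩
  obtain ⟨w, hw, hval, ht⟩ := hL' v hv
  refine ⟨w, hw, ?_, ht.length_le⟩
  have := hc' 1 (val v)
  rw [hone, vertexDist_one_left, vertexDist_one_left, ← hval] at this
  rw [add_mul]
  omega

theorem exists_vertexDist_hom_le (hX : IsGenSet X) (hY : IsGenSet Y) (φ : H →* G) :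
    ∃ c, ∀ h h', vertexDist X (φ h) (φ h') ≤ c * vertexDist Y h h' := by
  obtain ⟨c, hc⟩ := (Y.finite_toSet.image fun y => geodLength X (φ y)).bddAbove
  refine ⟨c, hY.vertexDist_map_le hX fun h y hy => ?_⟩
  rw [vertexDist, map_mul, inv_mul_cancel_left]
  exact hc ⟨y, hy, rfl⟩

/-- A retraction `ρ` of `G` onto a subgroup of finite index that commutes with left multiplication
by elements of the subgroup; the subgroup is given as the image of an injective homomorphism. The
remainders `(φ (ρ g))⁻¹ * g` form a finite right transversal. -/
structure IsCosetRetraction (φ : H →* G) (ρ : G → H) : Prop where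
  apply_one : ρ 1 = 1
  apply_hom_mul : ∀ h g, ρ (φ h * g) = h * ρ g
  finite_range : (Set.range fun g => (φ (ρ g))⁻¹ * g).Finite

theorem exists_isCosetRetraction (φ : H →* G) (hφ : Function.Injective φ)
    (hfin : φ.range.FiniteIndex) : ∃ ρ, IsCosetRetraction φ ρ := by
  let q : G → Quotient (QuotientGroup.rightRel φ.range) := Quotient.mk _
  have : Finite (Quotient (QuotientGroup.rightRel φ.range)) :=
    .of_equiv _ (QuotientGroup.quotientRightRelEquivQuotientLeftRel φ.range).symm
  have hq (h : H) (g : G) : q (φ h * g) = q g := by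
    refine Quotient.sound (QuotientGroup.rightRel_apply.mpr ?_)
    simp
  have hout (g : G) : ∃ h, φ h = g * (q g).out⁻¹ :=
    QuotientGroup.rightRel_apply.mp (Quotient.mk_out (s := QuotientGroup.rightRel φ.range) g)
  choose ρ hρ using hout
  have hmul (h : H) (g : G) : ρ (φ h * g) = h * ρ g := by
    apply hφ
    rw [map_mul, hρ, hρ, hq, mul_assoc]
  refine ⟨fun g => ρ g * (ρ 1)⁻¹, mul_inv_cancel _, fun h g => by rw [hmul, mul_assoc], ?_⟩
  refine (Set.finite_range fun s : Quotient (QuotientGroup.rightRel φ.range) =>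
    φ (ρ 1) * s.out).subset ?_
  rintro _ ⟨g, rfl⟩
  refine ⟨q g, ?_⟩
  simp only [map_mul, map_inv, mul_inv_rev, inv_inv, hρ g]
  group

namespace IsCosetRetraction

variable {φ : H →* G} {ρ : G → H}

/-- The remainder of an element: the element of the transversal in its coset. -/
def rem (φ : H →* G) (ρ : G → H) (g : G) : G := (φ (ρ g))⁻¹ * g

theorem mul_rem (g : G) : φ (ρ g) * rem φ ρ g = g := mul_inv_cancel_left _ _

theorem rem_one (hρ : IsCosetRetraction φ ρ) : rem φ ρ 1 = 1 := by
  rw [rem, hρ.apply_one, map_one, inv_one, one_mul]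

theorem apply_hom (hρ : IsCosetRetraction φ ρ) (h : H) : ρ (φ h) = h := by
  have := hρ.apply_hom_mul h 1
  rwa [mul_one, hρ.apply_one, mul_one] at this

theorem apply_mul (hρ : IsCosetRetraction φ ρ) (g x : G) :
    ρ (g * x) = ρ g * ρ (rem φ ρ g * x) := by
  rw [← hρ.apply_hom_mul, ← mul_assoc, mul_rem]

theorem rem_mul (hρ : IsCosetRetraction φ ρ) (g x : G) :
    rem φ ρ (rem φ ρ g * x) = rem φ ρ (g * x) := by
  change (φ (ρ (rem φ ρ g * x)))⁻¹ * ((φ (ρ g))⁻¹ * g * x) = (φ (ρ (g * x)))⁻¹ * (g * x)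
  rw [hρ.apply_mul g x, map_mul, mul_inv_rev]
  simp only [mul_assoc]

theorem apply_rem (hρ : IsCosetRetraction φ ρ) (g : G) : ρ (rem φ ρ g) = 1 := by
  have := hρ.apply_hom_mul (ρ g) (rem φ ρ g)
  rwa [mul_rem, eq_comm, mul_eq_left] at this

theorem exists_vertexDist_le (hρ : IsCosetRetraction φ ρ) (hX : IsGenSet X) (hY : IsGenSet Y) :
    ∃ c, ∀ g g', vertexDist Y (ρ g) (ρ g') ≤ c * vertexDist X g g' := by
  obtain ⟨c, hc⟩ := ((hρ.finite_range.prod X.finite_toSet).image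
    fun s => geodLength Y (ρ (s.1 * s.2))).bddAbove
  refine ⟨c, hX.vertexDist_map_le hY fun g x hx => ?_⟩
  rw [vertexDist, hρ.apply_mul, inv_mul_cancel_left]
  exact hc ⟨(rem φ ρ g, x), ⟨⟨g, rfl⟩, hx⟩, rfl⟩

end IsCosetRetraction

open IsCosetRetraction

/-- A combing of a group yields combings of its subgroups of finite index: the words representing
elements of the subgroup are rewritten in Schreier generators. -/
theorem exists_combing_subgroup (φ : H →* G) (hφ : Function.Injective φ)
    (hfin : φ.range.FiniteIndex) (hX : IsGenSet X) (hY : IsGenSet Y) {kind : Kind}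
    {L : Language X} (hL : IsRealTimeCombing kind L) :
    ∃ L' : Language Y, IsRealTimeCombing kind L' ∧
      ∀ d, LengthPolyBounded L d → LengthPolyBounded L' d := by
  by_cases hsub : ∀ y y' : Y, y = y'
  · obtain ⟨L', hL', hd⟩ := exists_combing_of_geodLength_le hY
      (geodLength_le_one_of_subsingleton hY hsub) kind
    exact ⟨L', hL', fun d _ => hd d⟩
  push Not at hsub
  obtain ⟨y₀, y₁, hy⟩ := hsub
  obtain ⟨ρ, hρ⟩ := exists_isCosetRetraction φ hφ hfin
  have := hρ.finite_range.to_subtype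
  let toRem (g : G) : Set.range fun g => (φ (ρ g))⁻¹ * g := ⟨rem φ ρ g, g, rfl⟩
  let next (t : Set.range fun g => (φ (ρ g))⁻¹ * g) (x : X) := toRem (t * x)
  obtain ⟨N, code, hN, hlen, hpre, hnil, hconcat, hrt⟩ := exists_realTime_encoding hY hy
    next (fun t x => ρ (t * x)) (toRem 1)
  have hstate (w : List X) : w.foldl next (toRem 1) = toRem (val w) := by
    induction w using List.reverseRecOn with
    | nil => rfl
    | append_singleton w x ih =>
      rw [List.foldl_append, ih]
      exact Subtype.ext (by simpa [next, toRem] using hρ.rem_mul (val w) x)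
  have hval (w : List X) : val (code w) = ρ (val w) := by
    induction w using List.reverseRecOn with
    | nil => rw [hnil, val_nil, hρ.apply_one]
    | append_singleton w x ih =>
      rw [hconcat, ih, hstate]
      simpa [toRem] using (hρ.apply_mul (val w) x).symm
  refine ⟨_, isRealTimeCombing_of_tracks hX hY (hρ.exists_vertexDist_le hX hY)
    (exists_vertexDist_hom_le hX hY φ) (map_one φ) hN (C := 1) hL ?_
    (hrt hL.realTime {toRem 1} some) ?_⟩
  · intro h
    obtain ⟨w, hw, hwh⟩ := hL.represents (φ h)
    refine ⟨code w, ⟨w, rfl, ?_, by simpa using hw⟩, by rw [hval, hwh, hρ.apply_hom]⟩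
    rw [hstate, hwh]
    refine Subtype.ext ?_
    simp only [toRem, rem_one hρ]
    rw [rem, hρ.apply_hom, inv_mul_cancel]
  · rintro _ ⟨w, rfl, hw, hwL⟩
    have hrem : rem φ ρ (val w) = 1 := by
      rw [hstate] at hw
      exact (congrArg Subtype.val hw).trans hρ.rem_one
    refine ⟨w, by simpa using hwL, ?_, ?_⟩
    · have := mul_rem (φ := φ) (ρ := ρ) (val w)
      rw [hval]
      rwa [hrem, mul_one, eq_comm] at this
    · exact .of_prefixes le_rfl (hlen w).2 (hlen w).1 fun i hi =>
        ⟨code (w.take i), hpre _ _ (List.take_prefix i w),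
          by simpa [hi] using (hlen (w.take i)).1, by simpa [hi] using (hlen (w.take i)).2, hval _⟩

/-- The phases of reading a word over `Y` followed by a single element of a transversal. -/
inductive Phase
  | reading
  | done
  | failed

instance : Finite Phase :=
  .of_surjective ![Phase.reading, Phase.done, Phase.failed] fun
    | .reading => ⟨0, rfl⟩
    | .done => ⟨1, rfl⟩
    | .failed => ⟨2, rfl⟩

/-- The transitions between the phases: the letters `Sum.inr t` stand for the elements of the
transversal. -/
def Phase.next {A T : Type*} : Phase → A ⊕ T → Phase
  | .reading, .inl _ => .reading
  | .reading, .inr _ => .done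
  | _, _ => .failed

theorem Phase.foldl_next {A T : Type*} (w : List (A ⊕ T)) :
    (w.foldl Phase.next .reading = .reading → ∃ u : List A, w = u.map Sum.inl) ∧
    (w.foldl Phase.next .reading = .done → ∃ (u : List A) (t : T),
      w = u.map Sum.inl ++ [Sum.inr t]) := by
  induction w using List.reverseRecOn with
  | nil => exact ⟨fun _ => ⟨[], rfl⟩, fun h => by cases h⟩
  | append_singleton w a ih =>
    rw [List.foldl_append, List.foldl_cons, List.foldl_nil]
    rcases hw : w.foldl Phase.next .reading <;> rcases a with a | t <;>
      simp only [Phase.next, reduceCtorEq, false_imp_iff, true_imp_iff, and_true, true_and]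
    · obtain ⟨u, rfl⟩ := ih.1 hw
      exact ⟨u ++ [a], by simp⟩
    · obtain ⟨u, rfl⟩ := ih.1 hw
      exact ⟨u, t, rfl⟩

theorem Phase.foldl_map_inl {A T : Type*} (u : List A) :
    (u.map (Sum.inl : A → A ⊕ T)).foldl Phase.next .reading = .reading := by
  induction u with
  | nil => rfl
  | cons a u ih => exact ih

/-- A combing of a subgroup of finite index yields combings of the group: the words are extended by
an element of a transversal. -/
theorem exists_combing_of_subgroup (φ : H →* G) (hφ : Function.Injective φ)
    (hfin : φ.range.FiniteIndex) (hX : IsGenSet X) (hY : IsGenSet Y) {kind : Kind}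
    {L : Language Y} (hL : IsRealTimeCombing kind L) :
    ∃ L' : Language X, IsRealTimeCombing kind L' ∧
      ∀ d, LengthPolyBounded L d → LengthPolyBounded L' d := by
  by_cases hsub : ∀ x x' : X, x = x'
  · obtain ⟨L', hL', hd⟩ := exists_combing_of_geodLength_le hX
      (geodLength_le_one_of_subsingleton hX hsub) kind
    exact ⟨L', hL', fun d _ => hd d⟩
  push Not at hsub
  obtain ⟨x₀, x₁, hx⟩ := hsub
  obtain ⟨ρ, hρ⟩ := exists_isCosetRetraction φ hφ hfin
  let T : Set G := Set.range fun g => (φ (ρ g))⁻¹ * g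
  have : Finite T := hρ.finite_range.to_subtype
  let elem : Y ⊕ T → G := Sum.elim (fun y => φ y) (fun t => t)
  obtain ⟨N, code, hN, hlen, hpre, hnil, hconcat, hrt⟩ := exists_realTime_encoding hX hx
    (Phase.next (A := Y) (T := T)) (fun _ => elem) .reading
  have hvalY (w : List Y) : val (code (w.map Sum.inl)) = φ (val w) := by
    induction w using List.reverseRecOn with
    | nil => rw [List.map_nil, hnil, val_nil, map_one]
    | append_singleton w y ih =>
      rw [List.map_append, List.map_singleton, hconcat, ih]
      simp [elem]
  have hval (w : List Y) (t : T) :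
      val (code (w.map Sum.inl ++ [Sum.inr t])) = φ (val w) * t := by
    rw [hconcat, hvalY]
    rfl
  have hfilter (w : List Y) (t : T) :
      (w.map Sum.inl ++ [Sum.inr t]).filterMap (Sum.getLeft? : Y ⊕ T → Option Y) = w := by
    simp [List.filterMap_map, Function.comp_def]
  refine ⟨_, isRealTimeCombing_of_tracks hY hX (exists_vertexDist_hom_le hX hY φ)
    (hρ.exists_vertexDist_le hX hY) hρ.apply_one hN (C := N + 1) hL ?_
    (hrt hL.realTime {Phase.done} Sum.getLeft?) ?_⟩
  · intro g
    obtain ⟨w, hw, hwg⟩ := hL.represents (ρ g)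
    refine ⟨code (w.map Sum.inl ++ [Sum.inr ⟨rem φ ρ g, g, rfl⟩]), ⟨_, rfl, ?_, ?_⟩, ?_⟩
    · rw [List.foldl_append, Phase.foldl_map_inl]
      rfl
    · rwa [hfilter]
    · rw [hval, hwg, mul_rem]
  · rintro _ ⟨w', rfl, hw', hwL⟩
    obtain ⟨w, t, rfl⟩ := (Phase.foldl_next w').2 hw'
    rw [hfilter] at hwL
    refine ⟨w, hwL, ?_, ?_⟩
    · obtain ⟨g, hg⟩ := t.2
      have hone : ρ t = 1 := hg ▸ hρ.apply_rem g
      rw [hval, hρ.apply_hom_mul, hone, mul_one]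
    · have h := hlen (w.map Sum.inl ++ [Sum.inr t])
      simp only [List.length_append, List.length_map, List.length_singleton, mul_add, mul_one] at h
      refine .of_prefixes (Nat.le_add_left 1 N) (h.2.trans (by omega)) (by omega) fun i hi =>
        ⟨code ((w.take i).map Sum.inl), hpre _ _ ?_,
          by simpa [hi] using (hlen ((w.take i).map Sum.inl)).1,
          by simpa [hi] using (hlen ((w.take i).map Sum.inl)).2, hvalY _⟩
      exact ((List.take_prefix i w).map _).trans (List.prefix_append _ _)

theorem exists_isGenSet (G : Type u) [Group G] [Group.FG G] : ∃ X : Finset G, IsGenSet X := by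
  classical
  obtain ⟨S, hS⟩ := Group.FG.out (G := G)
  refine ⟨S ∪ S.image (·⁻¹), eq_top_mono (Subgroup.closure_mono (by simp)) hS, fun x hx => ?_⟩
  simp only [Finset.mem_union, Finset.mem_image] at hx ⊢
  rcases hx with hx | ⟨y, hy, rfl⟩
  · exact Or.inr ⟨x, hx, rfl⟩
  · exact Or.inl (by simpa using hy)

end FiniteIndex

end Combing

theorem mainTheorem8 {G : Type u} [Group G] [Group.FG G] (kind : Combing.Kind) :
    (∀ X Y : Finset G, Combing.IsGenSet X → Combing.IsGenSet Y →
      ∀ L : Language X, Combing.IsRealTimeCombing kind L →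
        ∃ L' : Language Y, Combing.IsRealTimeCombing kind L' ∧
          ∀ d : ℕ, Combing.LengthPolyBounded L d → Combing.LengthPolyBounded L' d) ∧
    (∀ H : Subgroup G, H.FiniteIndex →
      (Combing.RealTimeCombable kind G ↔ Combing.RealTimeCombable kind H) ∧
      ∀ (X : Finset G) (Y : Finset H), Combing.IsGenSet X → Combing.IsGenSet Y →
        (∀ L : Language X, Combing.IsRealTimeCombing kind L →
          ∃ L' : Language Y, Combing.IsRealTimeCombing kind L' ∧
            ∀ d : ℕ, Combing.LengthPolyBounded L d → Combing.LengthPolyBounded L' d) ∧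
        (∀ L : Language Y, Combing.IsRealTimeCombing kind L →
          ∃ L' : Language X, Combing.IsRealTimeCombing kind L' ∧
            ∀ d : ℕ, Combing.LengthPolyBounded L d → Combing.LengthPolyBounded L' d)) := by
  refine ⟨fun X Y hX hY L hL => ?_, fun H hH => ?_⟩
  · refine Combing.exists_combing_subgroup (MonoidHom.id G) Function.injective_id ?_ hX hY hL
    rw [MonoidHom.range_eq_top.mpr Function.surjective_id]
    infer_instance
  · have hH' : H.subtype.range.FiniteIndex := by rwa [H.range_subtype]
    refine ⟨⟨?_, ?_⟩, fun X Y hX hY => ⟨fun L hL => ?_, fun L hL => ?_⟩⟩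
    · rintro ⟨X, hX, L, hL⟩
      obtain ⟨Y, hY⟩ := Combing.exists_isGenSet H
      obtain ⟨L', hL', -⟩ :=
        Combing.exists_combing_subgroup H.subtype H.subtype_injective hH' hX hY hL
      exact ⟨Y, hY, L', hL'⟩
    · rintro ⟨Y, hY, L, hL⟩
      obtain ⟨X, hX⟩ := Combing.exists_isGenSet G
      obtain ⟨L', hL', -⟩ :=
        Combing.exists_combing_of_subgroup H.subtype H.subtype_injective hH' hX hY hL
      exact ⟨X, hX, L', hL'⟩
    · exact Combing.exists_combing_subgroup H.subtype H.subtype_injective hH' hX hY hL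
    · exact Combing.exists_combing_of_subgroup H.subtype H.subtype_injective hH' hX hY hL
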